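/- Let $S$ be an infinite, connected, countable network, i.e. a graph each of whose edges $e$ carries a conductance $c(e)$; write $\pi(x)$ for the sum of the conductances of the edges that have $x$ as an endpoint, and suppose that $S$ is $\gamma$-bounded: for some constant $\gamma>0$, $\gamma<\pi(x)<\gamma^{-1}$ and $\gamma<c(e)<\gamma^{-1}$ for every vertex $x$ and edge $e$. Let $P(x,y)=c(\{x,y\})/\pi(x)$ for neighbors $x,y$ (and $P(x,y)=0$ otherwise) be the kernel of simple random walk on $S$. Activated random walk (ARW) with kernel $P$, sleep rate $\lambda\in(0,\infty]$ and initial occupation $\eta_0:S\to\{0,1,2,\dots\}$ is the following particle system. At time $0$ there are $\eta_0(x)$ particles at each vertex $x$. Each particle has a rate-one Poisson clock, all clocks being independent; when its clock rings, a particle that is active and located at $x$ hops to $y$ with probability $P(x,y)$, independently of the past, while a sleeping particle stays put. Particles that share a vertex are all active. If $\lambda<\infty$, all particles start active, an active particle that is alone at its vertex falls asleep at rate $\lambda$, independently of the rest, and a sleeping particle stays asleep until another particle hops to its vertex. If $\lambda=\infty$, a particle is sleeping if and only if it is alone at its vertex. The process is understood to be well defined: only finitely many particles reach any given vertex in finite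 time. The triplet $(S,\eta_0,P)$ is called nonfixating if for every $\lambda\in(0,\infty]$, every vertex $x$ and every $r\in\mathbb N$, almost surely $x$ is visited by an active particle at least $r$ distinct times. Let now $\{\eta_0(x)\}_{x\in S}$ be pairwise uncorrelated random variables with values in $\{0,1,2,\dots\}$, all with mean $1+\epsilon$ for some $\epsilon>0$ and with uniformly bounded variances. Then, for almost every realization of $\eta_0$, the triplet $(S,\eta_0,P)$ is nonfixating. In particular, for almost every realization of such an $\eta_0$, this holds for simple random walk on an infinite connected graph of bounded degree (the walk moves from $x$ to each neighbor with probability $1/\deg x$). -/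

import Mathlib

open MeasureTheory ProbabilityTheory Filter Topology
open scoped NNReal ENNReal

universe u v w

/-! ### Networks and simple random walk -/

/-- A network: a graph together with conductances on its edges
(only the values of `cond` on edges of `graph` matter). -/
structure Network (V : Type u) where
  graph : SimpleGraph V
  cond : Sym2 V → ℝ

namespace Network

/-- The weight `π(x)`: the sum of the conductances of the edges that have `x` as an endpoint. -/
noncomputable def weight {V : Type u} (N : Network V) (x : V) : ℝ :=
  ∑' e : N.graph.incidenceSet x, N.cond e

open Classical in
/-- The transition kernel of simple random walk on the network. -/
noncomputable def kernel {V : Type u} (N : Network V) (x y : V) : ℝ :=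
  if N.graph.Adj x y then N.cond s(x, y) / N.weight x else 0

/-- All weights and all conductances lie strictly between `γ` and `γ⁻¹`.
(In particular every sum defining a weight converges, since `∑'` is `0` otherwise.) -/
def IsBounded {V : Type u} (N : Network V) (γ : ℝ) : Prop :=
  0 < γ ∧ (∀ x, γ < N.weight x ∧ N.weight x < γ⁻¹) ∧
    ∀ e ∈ N.graph.edgeSet, γ < N.cond e ∧ N.cond e < γ⁻¹

end Network

open Classical in
/-- The transition kernel of simple random walk on a graph with finite degrees. -/
noncomputable def graphKernel {V : Type u} (G : SimpleGraph V) (x y : V) : ℝ :=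
  if G.Adj x y then 1 / ((G.neighborSet x).ncard : ℝ) else 0

/-! ### Poisson clocks -/

/-- `N i t` is the number of rings of clock `i` in `(0, t]`. The clocks are independent Poisson
processes of rates `rate i` with respect to the filtration `ℱ`: for `s ≤ t`, the numbers of rings
in `(s, t]` are Poisson, independent of each other, and jointly independent of the past `ℱ s`. -/
structure IsPoissonClocks {ι : Type u} {Ω : Type w} {m : MeasurableSpace Ω} (μ : Measure Ω)
    (ℱ : Filtration ℝ≥0 m) (rate : ι → ℝ≥0) (N : ι → ℝ≥0 → Ω → ℕ) : Prop where
  zero : ∀ i ω, N i 0 ω = 0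
  mono : ∀ i ω, Monotone fun t => N i t ω
  right_cont : ∀ i ω t, ∀ᶠ s in 𝓝[>] t, N i s ω = N i t ω
  adapted : ∀ i t, Measurable[ℱ t] (N i t)
  law : ∀ i s t, s ≤ t →
    μ.map (fun ω => N i t ω - N i s ω) = poissonMeasure (rate i * (t - s))
  indep : ∀ s t, s ≤ t →
    iIndep (fun j : Option ι => j.elim (ℱ s : MeasurableSpace Ω)
      fun i => MeasurableSpace.comap (fun ω => N i t ω - N i s ω) ⊤) μ

/-- A clock with ring count `N` rings at time `t`. -/
def Rings (N : ℝ≥0 → ℕ) (t : ℝ≥0) : Prop :=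
  0 < t ∧ ∀ s < t, N s < N t

/-! ### Activated random walk -/

/-- The value just before time `t > 0` of the piecewise constant path `f` is `a`. -/
def Before {α : Type u} (f : ℝ≥0 → α) (t : ℝ≥0) (a : α) : Prop :=
  ∀ᶠ s in 𝓝[<] t, f s = a

/-- The particles: there are `η₀ x` of them starting at `x`. -/
abbrev Particle {V : Type u} (η₀ : V → ℕ) : Type u := Σ x : V, Fin (η₀ x)

/-- A particle with jump clock `N` and path `st` hops from `x` to `y` at time `t`: it is at `x` and
active just before `t`, its clock rings at `t`, and at time `t` it is at `y`. A state is a pair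
consisting of the vertex and of `true` (active) or `false` (sleeping). -/
def HopsAt {V : Type u} (N : ℝ≥0 → ℕ) (st : ℝ≥0 → V × Bool) (t : ℝ≥0) (x y : V) : Prop :=
  Rings N t ∧ Before st t (x, true) ∧ (st t).1 = y

/-- The rules obeyed by a trajectory of activated random walk with sleep rate `lam` (possibly
infinite), given the ring counts of the jump clocks and of the sleep clocks of the particles.
The sleep clocks are used for finite `lam` only. -/
structure IsARWPath {V : Type u} (η₀ : V → ℕ) (lam : ℝ≥0∞)
    (jump sleep : Particle η₀ → ℝ≥0 → ℕ) (st : Particle η₀ → ℝ≥0 → V × Bool) : Prop where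
  /-- initially there are `η₀ x` particles at `x` -/
  init : ∀ p, (st p 0).1 = p.1
  right_cont : ∀ p t, ∀ᶠ s in 𝓝[>] t, st p s = st p t
  left_lim : ∀ p t, 0 < t → ∃ a, Before (st p) t a
  /-- a particle moves only when its jump clock rings while it is active -/
  stay : ∀ p t x a, 0 < t → Before (st p) t (x, a) → ¬ (a = true ∧ Rings (jump p) t) →
    (st p t).1 = x
  /-- A particle that shares its vertex is active. If the sleep rate is infinite, then all other
  particles are sleeping. If it is finite, then a particle that is alone is active precisely if it
  has just started or hopped, or was active before and its sleep clock does not ring. -/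
  active : ∀ p t, (st p t).2 = true ↔
    (∃ q, q ≠ p ∧ (st q t).1 = (st p t).1) ∨
      (lam ≠ ⊤ ∧ (t = 0 ∨ (∃ x y, HopsAt (jump p) (st p) t x y) ∨
        ((∃ x, Before (st p) t (x, true)) ∧ ¬ Rings (sleep p) t)))
  /-- only finitely many particles reach a vertex in finite time -/
  locally_finite : ∀ x t, {p | ∃ s ≤ t, (st p s).1 = x}.Finite

/-- A realization, on a probability space, of the activated random walk with jump kernel `K`,
initial occupation `η₀` and sleep rate `lam`. Each particle has a jump clock of rate one
(`clock (Sum.inl p)`) and a sleep clock of rate `lam` (`clock (Sum.inr p)`, which never rings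
and is not used if `lam = ⊤`), all independent. -/
structure ARW {V : Type u} (K : V → V → ℝ) (η₀ : V → ℕ) (lam : ℝ≥0∞)
    {Ω : Type w} {m : MeasurableSpace Ω} (μ : Measure Ω) where
  ℱ : Filtration ℝ≥0 m
  clock : Particle η₀ ⊕ Particle η₀ → ℝ≥0 → Ω → ℕ
  state : Particle η₀ → ℝ≥0 → Ω → V × Bool
  poisson : IsPoissonClocks μ ℱ (Sum.elim (fun _ => 1) fun _ => lam.toNNReal) clock
  adapted : ∀ p t a, MeasurableSet[ℱ t] {ω | state p t ω = a}
  path : ∀ᵐ ω ∂μ, IsARWPath η₀ lam (fun p t => clock (Sum.inl p) t ω)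
    (fun p t => clock (Sum.inr p) t ω) (fun p t => state p t ω)
  /-- Given everything that happened before the `n`-th ring of its jump clock, a particle which is
  then active at `x` hops to `y` with probability `K x y`. (The events `A ∩ {s < T}` with
  `A ∈ ℱ s` generate the past strictly before the time `T` of that ring.) -/
  hop_law : ∀ (p : Particle η₀) (n : ℕ) (x y : V) (s : ℝ≥0) (A : Set Ω), MeasurableSet[ℱ s] A →
    μ.real (A ∩ {ω | ∃ t > s, clock (Sum.inl p) t ω = n ∧
        HopsAt (fun t => clock (Sum.inl p) t ω) (fun t => state p t ω) t x y}) =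
      K x y * μ.real (A ∩ {ω | ∃ t > s, clock (Sum.inl p) t ω = n ∧
        ∃ z, HopsAt (fun t => clock (Sum.inl p) t ω) (fun t => state p t ω) t x z})

/-- The times at which the vertex `x` is visited by an active particle: a particle
hops to `x` and is active there on arrival. -/
def ARW.visitTimes {V : Type u} {K : V → V → ℝ} {η₀ : V → ℕ} {lam : ℝ≥0∞}
    {Ω : Type w} {m : MeasurableSpace Ω} {μ : Measure Ω} (Z : ARW K η₀ lam μ) (x : V) (ω : Ω) :
    Set ℝ≥0 :=
  {t | ∃ p z, HopsAt (fun t => Z.clock (Sum.inl p) t ω) (fun t => Z.state p t ω) t z x ∧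
    (Z.state p t ω).2 = true}

/-- The triplet `(V, η₀, K)` is nonfixating at `x`: for every positive or infinite sleep rate and
every `r`, almost surely `x` is visited by an active particle at least `r` distinct times. -/
def NonfixatingAt {V : Type u} (K : V → V → ℝ) (η₀ : V → ℕ) (x : V) : Prop :=
  ∀ (lam : ℝ≥0∞), 0 < lam → ∀ (Ω : Type w) [MeasurableSpace Ω] (μ : Measure Ω),
    IsProbabilityMeasure μ → ∀ (Z : ARW K η₀ lam μ) (r : ℕ),
      ∀ᵐ ω ∂μ, (r : ℕ∞) ≤ (Z.visitTimes x ω).encard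

/-- The triplet `(V, η₀, K)` is nonfixating: it is nonfixating at all vertices. -/
def Nonfixating {V : Type u} (K : V → V → ℝ) (η₀ : V → ℕ) : Prop :=
  ∀ x, NonfixatingAt.{u, w} K η₀ x

/-! ### Reversible nearest-neighbor kernels and their Green functions -/

/-- `K` is the kernel of a nearest-neighbor walk on the locally finite graph `G`, elliptic with
constant `γ` and reversible with respect to a weight bounded above and below;
`nb y` is the set of neighbors of `y`. -/
structure ReversibleWalk {V : Type u} (G : SimpleGraph V) (K : V → V → ℝ) (nb : V → Finset V)
    (wt : V → ℝ) (γ : ℝ) : Prop where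
  pos : 0 < γ
  mem_nb : ∀ y z, z ∈ nb y ↔ G.Adj y z
  lower : ∀ y z, G.Adj y z → γ ≤ K y z
  zero : ∀ y z, ¬ G.Adj y z → K y z = 0
  sum_one : ∀ y, ∑ z ∈ nb y, K y z = 1
  rev : ∀ y z, wt y * K y z = wt z * K z y
  wt_ge : ∀ y, γ ≤ wt y
  wt_le : ∀ y, wt y ≤ γ⁻¹

/-- The average of `f` after one step from `y`. -/
def stepAverage {V : Type u} (K : V → V → ℝ) (nb : V → Finset V) (f : V → ℝ) (y : V) : ℝ :=
  ∑ z ∈ nb y, K y z * f z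

/-- A function with values in `[0, 1]`, supported in `s`, which is subharmonic off `x`. -/
structure IsTestFunction {V : Type u} (K : V → V → ℝ) (nb : V → Finset V) (x : V)
    (s : Finset V) (h : V → ℝ) : Prop where
  nonneg : ∀ y, 0 ≤ h y
  le_one : ∀ y, h y ≤ 1
  support : ∀ y, y ∉ s → h y = 0
  subharmonic : ∀ y, y ≠ x → h y ≤ stepAverage K nb h y

open Classical in
/-- The probability that the walk started at `y` is at `x` after `k` steps. -/
noncomputable def returnProb {V : Type u} (K : V → V → ℝ) (nb : V → Finset V) (x : V) :
    ℕ → V → ℝ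
  | 0 => fun y => if y = x then 1 else 0
  | k + 1 => stepAverage K nb (returnProb K nb x k)

open Classical in
/-- The ball of radius `k` around `x`. -/
noncomputable def walkBall {V : Type u} (nb : V → Finset V) (x : V) : ℕ → Finset V
  | 0 => {x}
  | k + 1 => walkBall nb x k ∪ (walkBall nb x k).biUnion nb

/-- The expected number of visits to `x` in the first `n` steps of the walk started at `y`. -/
noncomputable def truncGreen {V : Type u} (K : V → V → ℝ) (nb : V → Finset V) (x : V)
    (n : ℕ) (y : V) : ℝ :=
  ∑ k ∈ Finset.range (n + 1), returnProb K nb x k y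

lemma walkBall_mono {V : Type u} (nb : V → Finset V) (x : V) : Monotone (walkBall nb x) := by
  classical
  exact monotone_nat_of_le_succ fun k => Finset.subset_union_left

namespace ReversibleWalk

variable {V : Type u} {G : SimpleGraph V} {K : V → V → ℝ} {nb : V → Finset V} {wt : V → ℝ} {γ : ℝ}

lemma kernel_nonneg (hK : ReversibleWalk G K nb wt γ) (y z : V) : 0 ≤ K y z := by
  by_cases h : G.Adj y z
  · exact hK.pos.le.trans (hK.lower y z h)
  · exact (hK.zero y z h).ge

lemma kernel_self (hK : ReversibleWalk G K nb wt γ) (y : V) : K y y = 0 :=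
  hK.zero y y (G.irrefl)

lemma kernel_zero_of_notMem (hK : ReversibleWalk G K nb wt γ) {y z : V} (h : z ∉ nb y) :
    K y z = 0 :=
  hK.zero y z fun h' => h ((hK.mem_nb y z).2 h')

lemma stepAverage_const (hK : ReversibleWalk G K nb wt γ) (c : ℝ) (y : V) :
    stepAverage K nb (fun _ => c) y = c := by
  rw [stepAverage, ← Finset.sum_mul, hK.sum_one, one_mul]

lemma stepAverage_sub_mul (f : V → ℝ) (hK : ReversibleWalk G K nb wt γ) (c a : ℝ) (y : V) :
    stepAverage K nb (fun z => c - a * f z) y = c - a * stepAverage K nb f y := by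
  have : stepAverage K nb (fun z => c - a * f z) y
      = stepAverage K nb (fun _ => c) y - a * stepAverage K nb f y := by
    simp only [stepAverage, Finset.mul_sum, ← Finset.sum_sub_distrib]
    exact Finset.sum_congr rfl fun z _ => by ring
  rw [this, hK.stepAverage_const]

lemma returnProb_nonneg (hK : ReversibleWalk G K nb wt γ) (x : V) (k : ℕ) (y : V) :
    0 ≤ returnProb K nb x k y := by
  induction k generalizing y with
  | zero => simp only [returnProb]; split_ifs <;> norm_num
  | succ k ih =>
    exact Finset.sum_nonneg fun z _ => mul_nonneg (hK.kernel_nonneg y z) (ih z)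

lemma returnProb_support (hK : ReversibleWalk G K nb wt γ) (x : V) (k : ℕ) (y : V)
    (hy : y ∉ walkBall nb x k) : returnProb K nb x k y = 0 := by
  classical
  induction k generalizing y with
  | zero => simpa [returnProb, walkBall] using hy
  | succ k ih =>
    refine Finset.sum_eq_zero fun z hz => ?_
    rw [ih z, mul_zero]
    intro hz'
    apply hy
    simp only [walkBall, Finset.mem_union, Finset.mem_biUnion]
    exact Or.inr ⟨z, hz', (hK.mem_nb z y).2 ((hK.mem_nb y z).1 hz).symm⟩

lemma sum_wt_stepAverage (hK : ReversibleWalk G K nb wt γ) (f : V → ℝ) (s t : Finset V)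
    (hf : ∀ y, y ∉ s → f y = 0) (hst : ∀ z ∈ s, nb z ⊆ t) :
    ∑ y ∈ t, wt y * stepAverage K nb f y = ∑ z ∈ s, wt z * f z := by
  classical
  have h1 : ∀ y, stepAverage K nb f y = ∑ z ∈ s, K y z * f z := by
    intro y
    have e1 : stepAverage K nb f y = ∑ z ∈ nb y ∪ s, K y z * f z :=
      Finset.sum_subset Finset.subset_union_left fun z _ hz => by
        rw [hK.kernel_zero_of_notMem hz, zero_mul]
    rw [e1]
    exact (Finset.sum_subset Finset.subset_union_right fun z _ hz => by
      rw [hf z hz, mul_zero]).symm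
  simp only [h1, Finset.mul_sum]
  rw [Finset.sum_comm]
  refine Finset.sum_congr rfl fun z hz => ?_
  have h2 : ∑ y ∈ t, K z y = 1 := by
    rw [← hK.sum_one z]
    exact (Finset.sum_subset (hst z hz) fun y _ hy => hK.kernel_zero_of_notMem hy).symm
  calc ∑ y ∈ t, wt y * (K y z * f z) = ∑ y ∈ t, wt z * f z * K z y :=
        Finset.sum_congr rfl fun y _ => by rw [← mul_assoc, hK.rev y z]; ring
    _ = wt z * f z := by rw [← Finset.mul_sum, h2, mul_one]

lemma sum_wt_returnProb (hK : ReversibleWalk G K nb wt γ) (x : V) (k : ℕ) :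
    ∑ y ∈ walkBall nb x k, wt y * returnProb K nb x k y = wt x := by
  classical
  induction k with
  | zero => simp [walkBall, returnProb]
  | succ k ih =>
    rw [← ih]
    refine hK.sum_wt_stepAverage _ _ _ (hK.returnProb_support x k) fun z hz y hy => ?_
    simp only [walkBall, Finset.mem_union, Finset.mem_biUnion]
    exact Or.inr ⟨z, hz, hy⟩

lemma sum_returnProb_ge (hK : ReversibleWalk G K nb wt γ) (x : V) (k : ℕ) {s : Finset V}
    (hs : walkBall nb x k ⊆ s) : γ ^ 2 ≤ ∑ y ∈ s, returnProb K nb x k y := by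
  have hγ := hK.pos
  calc γ ^ 2 ≤ γ * wt x := by nlinarith [hK.wt_ge x]
    _ = ∑ y ∈ walkBall nb x k, γ * (wt y * returnProb K nb x k y) := by
        rw [← Finset.mul_sum, hK.sum_wt_returnProb]
    _ ≤ ∑ y ∈ walkBall nb x k, returnProb K nb x k y := by
        refine Finset.sum_le_sum fun y _ => ?_
        have h1 : γ * wt y ≤ 1 := by
          calc γ * wt y ≤ γ * γ⁻¹ := mul_le_mul_of_nonneg_left (hK.wt_le y) hγ.le
            _ = 1 := mul_inv_cancel₀ hγ.ne'
        rw [← mul_assoc]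
        exact mul_le_of_le_one_left (hK.returnProb_nonneg x k y) h1
    _ ≤ ∑ y ∈ s, returnProb K nb x k y :=
        Finset.sum_le_sum_of_subset_of_nonneg hs fun y _ _ => hK.returnProb_nonneg x k y

lemma truncGreen_nonneg (hK : ReversibleWalk G K nb wt γ) (x : V) (n : ℕ) (y : V) :
    0 ≤ truncGreen K nb x n y :=
  Finset.sum_nonneg fun k _ => hK.returnProb_nonneg x k y

lemma one_le_truncGreen_self (hK : ReversibleWalk G K nb wt γ) (x : V) (n : ℕ) :
    1 ≤ truncGreen K nb x n x := by
  calc (1 : ℝ) = returnProb K nb x 0 x := by simp [returnProb]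
    _ ≤ truncGreen K nb x n x :=
      Finset.single_le_sum (f := fun k => returnProb K nb x k x)
        (fun k _ => hK.returnProb_nonneg x k x) (by simp)

lemma truncGreen_support (hK : ReversibleWalk G K nb wt γ) (x : V) (n : ℕ) (y : V)
    (hy : y ∉ walkBall nb x n) : truncGreen K nb x n y = 0 :=
  Finset.sum_eq_zero fun k hk => hK.returnProb_support x k y fun h =>
    hy (walkBall_mono nb x (Nat.lt_succ_iff.1 (Finset.mem_range.1 hk)) h)

lemma stepAverage_truncGreen (x : V) (n : ℕ) (y : V) :
    stepAverage K nb (truncGreen K nb x n) y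
      = truncGreen K nb x n y - returnProb K nb x 0 y + returnProb K nb x (n + 1) y := by
  have h1 : stepAverage K nb (truncGreen K nb x n) y
      = ∑ k ∈ Finset.range (n + 1), returnProb K nb x (k + 1) y := by
    simp only [stepAverage, truncGreen, Finset.mul_sum]
    rw [Finset.sum_comm]
    rfl
  rw [h1, truncGreen]
  have h2 := Finset.sum_range_succ' (fun k => returnProb K nb x k y) (n + 1)
  rw [Finset.sum_range_succ] at h2
  linarith

lemma truncGreen_subharmonic (hK : ReversibleWalk G K nb wt γ) (x : V) (n : ℕ) (y : V)
    (hy : y ≠ x) : truncGreen K nb x n y ≤ stepAverage K nb (truncGreen K nb x n) y := by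
  rw [stepAverage_truncGreen]
  have h0 : returnProb K nb x 0 y = 0 := by simp [returnProb, hy]
  have := hK.returnProb_nonneg x (n + 1) y
  linarith

/-- Maximum principle. -/
lemma le_of_subharmonic_off (hK : ReversibleWalk G K nb wt γ) (hG : G.Connected) (x : V)
    (s : Finset V) (f : V → ℝ) (hf0 : ∀ y, 0 ≤ f y) (hfs : ∀ y, y ∉ s → f y = 0)
    (hf : ∀ y, y ≠ x → f y ≤ stepAverage K nb f y) (y : V) : f y ≤ f x := by
  classical
  obtain ⟨m, hm, hmax⟩ := Finset.exists_max_image (insert x s) f ⟨x, Finset.mem_insert_self x s⟩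
  have hmax' : ∀ z, f z ≤ f m := by
    intro z
    by_cases hz : z ∈ s
    · exact hmax z (Finset.mem_insert_of_mem hz)
    · rw [hfs z hz]; exact hf0 m
  by_contra! hlt
  have hxm : f x < f m := hlt.trans_le (hmax' y)
  have key : ∀ z z', G.Adj z z' → f z = f m → f z' = f m := by
    intro z z' hzz' hz
    have hzx : z ≠ x := by rintro rfl; exact hxm.ne hz
    by_contra hne
    have hlt' : f z' < f m := lt_of_le_of_ne (hmax' z') hne
    have h1 : stepAverage K nb f z < stepAverage K nb (fun _ => f m) z := by
      refine Finset.sum_lt_sum (fun w _ => mul_le_mul_of_nonneg_left (hmax' w)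
        (hK.kernel_nonneg z w)) ⟨z', (hK.mem_nb z z').2 hzz', ?_⟩
      exact mul_lt_mul_of_pos_left hlt' (hK.pos.trans_le (hK.lower z z' hzz'))
    rw [hK.stepAverage_const] at h1
    have := hf z hzx
    linarith
  have hall : ∀ a b, G.Walk a b → f a = f m → f b = f m := by
    intro a b p
    induction p with
    | nil => exact id
    | cons h p ih => exact fun ha => ih (key _ _ h ha)
  obtain ⟨p⟩ := hG.preconnected m x
  exact hxm.ne (hall m x p rfl)

lemma truncGreen_le_self (hK : ReversibleWalk G K nb wt γ) (hG : G.Connected) (x : V) (n : ℕ)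
    (y : V) : truncGreen K nb x n y ≤ truncGreen K nb x n x :=
  hK.le_of_subharmonic_off hG x (walkBall nb x n) _ (hK.truncGreen_nonneg x n)
    (hK.truncGreen_support x n) (hK.truncGreen_subharmonic x n) y

lemma isTestFunction_truncGreen (hK : ReversibleWalk G K nb wt γ) (hG : G.Connected) (x : V)
    (n : ℕ) : IsTestFunction K nb x (walkBall nb x n)
      (fun y => (truncGreen K nb x n x)⁻¹ * truncGreen K nb x n y) := by
  have h1 := hK.one_le_truncGreen_self x n
  have hpos : 0 < truncGreen K nb x n x := by linarith
  refine ⟨fun y => mul_nonneg (inv_nonneg.2 hpos.le) (hK.truncGreen_nonneg x n y), fun y => ?_,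
    fun y hy => ?_, fun y hy => ?_⟩
  · rw [inv_mul_le_iff₀ hpos, mul_one]
    exact hK.truncGreen_le_self hG x n y
  · simp only [hK.truncGreen_support x n y hy, mul_zero]
  · have : stepAverage K nb (fun y => (truncGreen K nb x n x)⁻¹ * truncGreen K nb x n y) y
        = (truncGreen K nb x n x)⁻¹ * stepAverage K nb (truncGreen K nb x n) y := by
      simp only [stepAverage, Finset.mul_sum]
      exact Finset.sum_congr rfl fun z _ => by ring
    rw [this]
    exact mul_le_mul_of_nonneg_left (hK.truncGreen_subharmonic x n y hy) (inv_nonneg.2 hpos.le)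

/-- The truncated Green functions at `x` and at `y` differ by at most a constant. -/
lemma exists_truncGreen_sub_le (hK : ReversibleWalk G K nb wt γ) (hG : G.Connected) (x y : V) :
    ∃ C, ∀ n, truncGreen K nb x n x - truncGreen K nb x n y ≤ C := by
  obtain ⟨p⟩ := hG.preconnected y x
  induction p with
  | nil => exact ⟨0, fun n => by simp⟩
  | @cons a b c hab p ih =>
    obtain ⟨C, hC⟩ := ih
    refine ⟨γ⁻¹ * (C + 1), fun n => ?_⟩
    have hb := hC n
    set g := truncGreen K nb c n with hg
    have h1 : stepAverage K nb (fun z => g c - 1 * g z) b ≤ (g c - g b) + 1 := by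
      rw [hK.stepAverage_sub_mul, hg, stepAverage_truncGreen]
      have h0 : returnProb K nb c 0 b ≤ 1 := by
        simp only [returnProb]; split_ifs <;> norm_num
      have := hK.returnProb_nonneg c (n + 1) b
      linarith
    have hnn : ∀ z, 0 ≤ g c - 1 * g z := fun z => by
      have := hK.truncGreen_le_self hG c n z
      rw [← hg] at this; linarith
    have h2 : K b a * (g c - 1 * g a) ≤ stepAverage K nb (fun z => g c - 1 * g z) b :=
      Finset.single_le_sum (f := fun z => K b z * (g c - 1 * g z))
        (fun z _ => mul_nonneg (hK.kernel_nonneg b z) (hnn z)) ((hK.mem_nb b a).2 hab.symm)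
    have h3 : γ * (g c - 1 * g a) ≤ K b a * (g c - 1 * g a) :=
      mul_le_mul_of_nonneg_right (hK.lower b a hab.symm) (hnn a)
    rw [le_inv_mul_iff₀ hK.pos]
    linarith

/-- There are test functions with arbitrarily large sum. -/
theorem exists_testFunction [Infinite V] (hK : ReversibleWalk G K nb wt γ) (hG : G.Connected)
    (x : V) (M : ℝ) : ∃ s h, IsTestFunction K nb x s h ∧ M ≤ ∑ y ∈ s, h y := by
  classical
  by_contra! hcon
  have hM : ∀ n, ∑ y ∈ walkBall nb x n,
      (truncGreen K nb x n x)⁻¹ * truncGreen K nb x n y < M := fun n =>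
    hcon _ _ (hK.isTestFunction_truncGreen hG x n)
  have hpos : ∀ n, 0 < truncGreen K nb x n x := fun n => by
    linarith [hK.one_le_truncGreen_self x n]
  have hMpos : 0 < M := by
    refine lt_of_le_of_lt (Finset.sum_nonneg fun y _ => ?_) (hM 0)
    exact mul_nonneg (inv_nonneg.2 (hpos 0).le) (hK.truncGreen_nonneg x 0 y)
  have hlow : ∀ n : ℕ, (n + 1) * γ ^ 2 ≤ M * truncGreen K nb x n x := by
    intro n
    have h1 := hM n
    rw [← Finset.mul_sum, inv_mul_lt_iff₀ (hpos n)] at h1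
    have h2 : (n + 1) * γ ^ 2 ≤ ∑ y ∈ walkBall nb x n, truncGreen K nb x n y := by
      simp only [truncGreen]
      rw [Finset.sum_comm]
      have := Finset.card_nsmul_le_sum (Finset.range (n + 1))
        (fun k => ∑ y ∈ walkBall nb x n, returnProb K nb x k y) (γ ^ 2) fun k hk =>
          hK.sum_returnProb_ge x k
            (walkBall_mono nb x (Nat.lt_succ_iff.1 (Finset.mem_range.1 hk)))
      simpa using this
    linarith
  choose C hC using hK.exists_truncGreen_sub_le hG x
  obtain ⟨k, hk⟩ := exists_nat_ge (2 * M)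
  obtain ⟨t, -, ht⟩ := (Set.infinite_univ (α := V)).exists_subset_card_eq k
  obtain ⟨D, hD⟩ : ∃ D, ∀ y ∈ t, C y ≤ D := by
    obtain ⟨D, hD⟩ := (t.image C).exists_le
    exact ⟨D, fun y hy => hD _ (Finset.mem_image_of_mem C hy)⟩
  obtain ⟨n, hn⟩ := exists_nat_ge (2 * D * M / γ ^ 2)
  have hγ2 : 0 < γ ^ 2 := pow_pos hK.pos 2
  rw [div_le_iff₀ hγ2] at hn
  have hbig : 2 * D ≤ truncGreen K nb x n x := by
    have := hlow n
    by_contra! hlt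
    nlinarith
  have hhalf : ∀ y ∈ t, (1 / 2 : ℝ) ≤ (truncGreen K nb x n x)⁻¹ * truncGreen K nb x n y := by
    intro y hy
    rw [le_inv_mul_iff₀ (hpos n)]
    have := hC y n
    have := hD y hy
    linarith
  have hsub : t ⊆ walkBall nb x n := by
    intro y hy
    by_contra hy'
    have := hhalf y hy
    rw [hK.truncGreen_support x n y hy'] at this
    norm_num at this
  have h1 : ∑ y ∈ t, (1 / 2 : ℝ) ≤ ∑ y ∈ walkBall nb x n,
      (truncGreen K nb x n x)⁻¹ * truncGreen K nb x n y :=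
    (Finset.sum_le_sum hhalf).trans (Finset.sum_le_sum_of_subset_of_nonneg hsub fun y _ _ =>
      mul_nonneg (inv_nonneg.2 (hpos n).le) (hK.truncGreen_nonneg x n y))
  have h2 := hM n
  simp only [Finset.sum_const, ht, nsmul_eq_mul] at h1
  linarith

end ReversibleWalk

/-! ### Simple random walk on networks and on graphs of bounded degree -/

namespace Network

variable {V : Type u} {N : Network V} {γ : ℝ}

lemma IsBounded.summable_cond (h : N.IsBounded γ) (x : V) :
    Summable fun e : N.graph.incidenceSet x => N.cond e := by
  by_contra hs
  have h1 := (h.2.1 x).1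
  rw [weight, tsum_eq_zero_of_not_summable hs] at h1
  exact absurd h.1 h1.not_gt

lemma IsBounded.finite_incidenceSet (h : N.IsBounded γ) (x : V) :
    Finite (N.graph.incidenceSet x) := by
  have h1 := (h.summable_cond x).tendsto_cofinite_zero.eventually_lt_const h.1
  rw [← Set.finite_univ_iff]
  refine (show {e : N.graph.incidenceSet x | ¬ N.cond e < γ}.Finite from h1).subset ?_
  intro e _
  exact ((h.2.2 e e.2.1).1).not_gt

lemma IsBounded.finite_neighborSet (h : N.IsBounded γ) (x : V) :
    (N.graph.neighborSet x).Finite := by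
  classical
  have := h.finite_incidenceSet x
  exact Set.finite_coe_iff.1 (Finite.of_equiv _ (N.graph.incidenceSetEquivNeighborSet x))

lemma weight_eq_sum (N : Network V) {x : V} (hfin : (N.graph.neighborSet x).Finite) :
    N.weight x = ∑ z ∈ hfin.toFinset, N.cond s(x, z) := by
  classical
  have e1 : N.weight x = ∑' z : N.graph.neighborSet x, N.cond s(x, z) := by
    rw [weight, ← (N.graph.incidenceSetEquivNeighborSet x).symm.tsum_eq]
    rfl
  rw [e1, ← Finset.tsum_subtype' hfin.toFinset fun z => N.cond s(x, z), hfin.coe_toFinset]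

theorem IsBounded.exists_reversibleWalk (h : N.IsBounded γ) :
    ∃ nb wt γ', ReversibleWalk N.graph N.kernel nb wt γ' := by
  classical
  have hγ := h.1
  have hw : ∀ x, 0 < N.weight x := fun x => hγ.trans (h.2.1 x).1
  have h1 : V → γ < 1 := fun x => by
    have h2 := (h.2.1 x).1.trans (h.2.1 x).2
    by_contra! hle
    exact absurd (h2.trans_le (inv_le_one_of_one_le₀ hle)) hle.not_gt
  refine ⟨fun x => (h.finite_neighborSet x).toFinset, N.weight, γ ^ 2, pow_pos hγ 2, ?_, ?_, ?_,
    ?_, ?_, ?_, ?_⟩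
  · intro y z
    simp
  · intro y z hyz
    rw [kernel, if_pos hyz, le_div_iff₀ (hw y)]
    have h2 := (h.2.2 s(y, z) hyz).1
    have h3 := (h.2.1 y).2
    calc γ ^ 2 * N.weight y ≤ γ ^ 2 * γ⁻¹ := mul_le_mul_of_nonneg_left h3.le (by positivity)
      _ = γ := by field_simp
      _ ≤ _ := h2.le
  · intro y z hyz
    rw [kernel, if_neg hyz]
  · intro y
    have h2 : ∑ z ∈ (h.finite_neighborSet y).toFinset, N.kernel y z
        = ∑ z ∈ (h.finite_neighborSet y).toFinset, N.cond s(y, z) / N.weight y :=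
      Finset.sum_congr rfl fun z hz => by
        rw [kernel, if_pos (by simpa using hz)]
    rw [h2, ← Finset.sum_div, ← N.weight_eq_sum, div_self (hw y).ne']
  · intro y z
    by_cases hyz : N.graph.Adj y z
    · rw [kernel, kernel, if_pos hyz, if_pos hyz.symm, mul_div_cancel₀ _ (hw y).ne',
        mul_div_cancel₀ _ (hw z).ne', Sym2.eq_swap]
    · rw [kernel, kernel, if_neg hyz, if_neg fun h' => hyz h'.symm, mul_zero, mul_zero]
  · intro y
    have := h1 y
    have := (h.2.1 y).1
    nlinarith
  · intro y
    refine (h.2.1 y).2.le.trans (inv_anti₀ (pow_pos hγ 2) ?_)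
    have := h1 y
    nlinarith

end Network

/-- The network on the graph `G` with unit conductances. -/
def unitNetwork {V : Type u} (G : SimpleGraph V) : Network V := ⟨G, fun _ => 1⟩

lemma unitNetwork_weight {V : Type u} (G : SimpleGraph V) {x : V}
    (hfin : (G.neighborSet x).Finite) :
    (unitNetwork G).weight x = ((G.neighborSet x).ncard : ℝ) := by
  rw [(unitNetwork G).weight_eq_sum hfin, Set.ncard_eq_toFinset_card _ hfin]
  simp [unitNetwork]

lemma unitNetwork_kernel {V : Type u} (G : SimpleGraph V)
    (hfin : ∀ x, (G.neighborSet x).Finite) : (unitNetwork G).kernel = graphKernel G := by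
  classical
  ext x y
  rw [Network.kernel, graphKernel, unitNetwork_weight G (hfin x)]
  rfl

theorem unitNetwork_isBounded {V : Type u} [Nontrivial V] {G : SimpleGraph V} {d : ℕ}
    (hG : G.Connected) (hfin : ∀ x, (G.neighborSet x).Finite)
    (hd : ∀ x, (G.neighborSet x).encard ≤ d) :
    (unitNetwork G).IsBounded ((d : ℝ) + 2)⁻¹ := by
  have hlt : ((d : ℝ) + 2)⁻¹ < 1 := by
    have : (0 : ℝ) ≤ d := by positivity
    exact inv_lt_one_of_one_lt₀ (by linarith)
  refine ⟨by positivity, fun x => ?_, fun e _ => ⟨hlt, ?_⟩⟩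
  · rw [unitNetwork_weight G (hfin x), inv_inv]
    constructor
    · refine hlt.trans_le ?_
      have hne : (G.neighborSet x).Nonempty := hG.preconnected.exists_adj_of_nontrivial x
      have := (Set.ncard_pos (hfin x)).2 hne
      exact_mod_cast this
    · have h1 := hd x
      rw [← (hfin x).cast_ncard_eq] at h1
      have h2 : (G.neighborSet x).ncard ≤ d := by exact_mod_cast h1
      have h3 : ((G.neighborSet x).ncard : ℝ) ≤ d := by exact_mod_cast h2
      linarith
  · rw [inv_inv]
    have : (0 : ℝ) ≤ d := by positivity
    simp only [unitNetwork]
    linarith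

/-! ### Piecewise constant paths -/

lemma Before.exists_Ioo {α : Type u} {f : ℝ≥0 → α} {t : ℝ≥0} {a : α} (h : Before f t a)
    (ht : 0 < t) : ∃ l < t, ∀ s, l < s → s < t → f s = a := by
  obtain ⟨l, hl, hs⟩ := (mem_nhdsLT_iff_exists_Ioo_subset' ht).1 h
  exact ⟨l, hl, fun s h1 h2 => hs ⟨h1, h2⟩⟩

lemma Before.unique {α : Type u} {f : ℝ≥0 → α} {t : ℝ≥0} {a b : α} (ha : Before f t a)
    (hb : Before f t b) (ht : 0 < t) : a = b := by
  obtain ⟨l, hl, h1⟩ := ha.exists_Ioo ht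
  obtain ⟨l', hl', h2⟩ := hb.exists_Ioo ht
  obtain ⟨s, hs, hst⟩ := exists_between (max_lt hl hl')
  rw [← h1 s ((le_max_left _ _).trans_lt hs) hst, h2 s ((le_max_right _ _).trans_lt hs) hst]

lemma Before.comp {α : Type u} {β : Type v} {f : ℝ≥0 → α} {t : ℝ≥0} {a : α} (h : Before f t a)
    (g : α → β) : Before (fun s => g (f s)) t (g a) :=
  Filter.Eventually.mono h fun _ hs => congrArg g hs

lemma before_of_Ico {α : Type u} {f : ℝ≥0 → α} {s t : ℝ≥0} {a : α} (hst : s < t)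
    (h : ∀ r, s ≤ r → r < t → f r = a) : Before f t a := by
  refine (mem_nhdsLT_iff_exists_Ioo_subset' hst).2 ⟨s, hst, fun r hr => ?_⟩
  exact h r hr.1.le hr.2

/-- A piecewise constant path which is at `x` at time `t` but not at time `s` has a last entrance
into `x` in between. -/
lemma exists_last_entrance {α : Type u} {f : ℝ≥0 → α}
    (rc : ∀ t, ∀ᶠ s in 𝓝[>] t, f s = f t) (ll : ∀ t, 0 < t → ∃ a, Before f t a)
    {x : α} {s t : ℝ≥0} (hst : s ≤ t) (hs : f s ≠ x) (ht : f t = x) :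
    ∃ τ, s < τ ∧ τ ≤ t ∧ (∀ r, τ ≤ r → r ≤ t → f r = x) ∧ ∃ z, z ≠ x ∧ Before f τ z := by
  set S : Set ℝ≥0 := {τ | s ≤ τ ∧ τ ≤ t ∧ ∀ r, τ ≤ r → r ≤ t → f r = x} with hS
  have htS : t ∈ S := ⟨hst, le_rfl, fun r h1 h2 => le_antisymm h2 h1 ▸ ht⟩
  have hbdd : BddBelow S := OrderBot.bddBelow S
  have hle : sInf S ≤ t := csInf_le hbdd htS
  have hge : s ≤ sInf S := le_csInf ⟨t, htS⟩ fun b hb => hb.1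
  have hgt : ∀ r, sInf S < r → r ≤ t → f r = x := by
    intro r h1 h2
    obtain ⟨σ, hσ, hσr⟩ := exists_lt_of_csInf_lt ⟨t, htS⟩ h1
    exact hσ.2.2 r hσr.le h2
  have hat : f (sInf S) = x := by
    rcases hle.eq_or_lt with h | h
    · rw [h, ht]
    · obtain ⟨u, hu, hsub⟩ := mem_nhdsGT_iff_exists_Ioo_subset.1 (rc (sInf S))
      obtain ⟨r, hr1, hr2⟩ := exists_between (lt_min hu h)
      have h1 : f r = f (sInf S) := hsub ⟨hr1, hr2.trans_le (min_le_left _ _)⟩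
      rw [← h1]
      exact hgt r hr1 (hr2.le.trans (min_le_right _ _))
  have hlt : s < sInf S := lt_of_le_of_ne hge fun h => hs (h ▸ hat)
  refine ⟨sInf S, hlt, hle, fun r h1 h2 => ?_, ?_⟩
  · rcases h1.eq_or_lt with h | h
    · rw [← h, hat]
    · exact hgt r h h2
  · obtain ⟨z, hz⟩ := ll (sInf S) (pos_of_gt hlt)
    refine ⟨z, ?_, hz⟩
    rintro rfl
    obtain ⟨l, hl, hlx⟩ := hz.exists_Ioo (pos_of_gt hlt)
    obtain ⟨σ, hσ1, hσ2⟩ := exists_between (max_lt hl hlt)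
    refine absurd (csInf_le hbdd (show σ ∈ S from ⟨((le_max_right _ _).trans_lt hσ1).le,
      hσ2.le.trans hle, fun r h1 h2 => ?_⟩)) hσ2.not_ge
    rcases lt_trichotomy r (sInf S) with h | h | h
    · exact hlx r (((le_max_left _ _).trans_lt hσ1).trans_le h1) h
    · rw [h, hat]
    · exact hgt r h h2

/-- A right-continuous piecewise constant path which is at `x` at time `s` but not at time `t`
has a first exit from `x` in between. -/
lemma exists_first_exit {α : Type u} {f : ℝ≥0 → α}
    (rc : ∀ t, ∀ᶠ s in 𝓝[>] t, f s = f t)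
    {x : α} {s t : ℝ≥0} (hst : s ≤ t) (hs : f s = x) (ht : f t ≠ x) :
    ∃ τ, s < τ ∧ τ ≤ t ∧ (∀ r, s ≤ r → r < τ → f r = x) ∧ f τ ≠ x := by
  set S : Set ℝ≥0 := {τ | s ≤ τ ∧ f τ ≠ x} with hS
  have htS : t ∈ S := ⟨hst, ht⟩
  have hbdd : BddBelow S := OrderBot.bddBelow S
  have hge : s ≤ sInf S := le_csInf ⟨t, htS⟩ fun b hb => hb.1
  have hlt : ∀ r, s ≤ r → r < sInf S → f r = x := by
    intro r h1 h2
    by_contra h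
    exact absurd (csInf_le hbdd (show r ∈ S from ⟨h1, h⟩)) h2.not_ge
  have hat : f (sInf S) ≠ x := by
    intro h
    obtain ⟨u, hu, hsub⟩ := mem_nhdsGT_iff_exists_Ioo_subset.1 (rc (sInf S))
    obtain ⟨σ, hσ, hσu⟩ := exists_lt_of_csInf_lt ⟨t, htS⟩ hu
    rcases (csInf_le hbdd hσ).eq_or_lt with h' | h'
    · exact hσ.2 (h' ▸ h)
    · exact hσ.2 ((hsub ⟨h', hσu⟩ : f σ = f (sInf S)).trans h)
  refine ⟨sInf S, lt_of_le_of_ne hge ?_, csInf_le hbdd htS, hlt, hat⟩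
  intro h
  exact hat (h ▸ hs)

lemma exists_ring {N : ℝ≥0 → ℕ} (mono : Monotone N) (rc : ∀ t, ∀ᶠ s in 𝓝[>] t, N s = N t)
    {s t : ℝ≥0} (h : N s < N t) :
    ∃ τ, s < τ ∧ τ ≤ t ∧ Rings N τ ∧ ∀ r, s ≤ r → r < τ → N r = N s := by
  have hst : s ≤ t := by
    by_contra! hlt
    exact absurd (mono hlt.le) h.not_ge
  obtain ⟨τ, h1, h2, h3, h4⟩ := exists_first_exit rc hst rfl h.ne'
  refine ⟨τ, h1, h2, ⟨pos_of_gt h1, fun r hr => ?_⟩, h3⟩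
  have h5 : N r ≤ N s := by
    rw [← h3 (max r s) (le_max_right _ _) (max_lt hr h1)]
    exact mono (le_max_left _ _)
  exact h5.trans_lt (lt_of_le_of_ne (mono h1.le) h4.symm)

lemma finite_rings {N : ℝ≥0 → ℕ} (mono : Monotone N) (T : ℝ≥0) :
    {t | t ≤ T ∧ Rings N t}.Finite := by
  refine Set.Finite.of_finite_image (f := N) ((Set.finite_Iic (N T)).subset ?_) ?_
  · rintro _ ⟨t, ht, rfl⟩
    exact mono ht.1
  · intro t ht t' ht' heq
    rcases lt_trichotomy t t' with h | h | h
    · exact absurd heq (ht'.2.2 t h).ne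
    · exact h
    · exact absurd heq (ht.2.2 t' h).ne'

/-! ### Deterministic properties of trajectories of activated random walk -/

/-- The pairs of a particle and a time at which it hops from `y`. -/
def hopsFrom {V : Type u} {η₀ : V → ℕ} (jump : Particle η₀ → ℝ≥0 → ℕ)
    (st : Particle η₀ → ℝ≥0 → V × Bool) (y : V) : Set (Particle η₀ × ℝ≥0) :=
  {q | ∃ z, HopsAt (jump q.1) (st q.1) q.2 y z}

/-- The pairs of a particle and a time at which it hops to `y`. -/
def hopsTo {V : Type u} {η₀ : V → ℕ} (jump : Particle η₀ → ℝ≥0 → ℕ)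
    (st : Particle η₀ → ℝ≥0 → V × Bool) (y : V) : Set (Particle η₀ × ℝ≥0) :=
  {q | ∃ z, HopsAt (jump q.1) (st q.1) q.2 z y}

/-- The almost sure properties of trajectories. -/
structure IsRegularPath {V : Type u} (η₀ : V → ℕ) (lam : ℝ≥0∞)
    (jump sleep : Particle η₀ → ℝ≥0 → ℕ) (st : Particle η₀ → ℝ≥0 → V × Bool) : Prop
    extends IsARWPath η₀ lam jump sleep st where
  jump_mono : ∀ p, Monotone (jump p)
  jump_right_cont : ∀ p t, ∀ᶠ s in 𝓝[>] t, jump p s = jump p t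
  jump_unbounded : ∀ p k, ∃ t, k ≤ jump p t
  no_self_hop : ∀ p t y, ¬ HopsAt (jump p) (st p) t y y

namespace IsRegularPath

variable {V : Type u} {η₀ : V → ℕ} {lam : ℝ≥0∞} {jump sleep : Particle η₀ → ℝ≥0 → ℕ}
  {st : Particle η₀ → ℝ≥0 → V × Bool}

lemma pos_right_cont (H : IsRegularPath η₀ lam jump sleep st) (p : Particle η₀) (t : ℝ≥0) :
    ∀ᶠ s in 𝓝[>] t, (st p s).1 = (st p t).1 :=
  (H.right_cont p t).mono fun _ h => by rw [h]

lemma exists_hop_into (H : IsRegularPath η₀ lam jump sleep st) {p : Particle η₀} {s t : ℝ≥0}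
    {x : V} (hst : s ≤ t) (hs : (st p s).1 ≠ x) (ht : (st p t).1 = x) :
    ∃ τ, s < τ ∧ τ ≤ t ∧ (∀ r, τ ≤ r → r ≤ t → (st p r).1 = x) ∧
      ∃ z, HopsAt (jump p) (st p) τ z x := by
  obtain ⟨τ, h1, h2, h3, z, hz, hB⟩ := exists_last_entrance (f := fun t => (st p t).1)
    (H.pos_right_cont p)
    (fun t ht => (H.left_lim p t ht).elim fun a ha => ⟨a.1, ha.comp Prod.fst⟩) hst hs ht
  have hτ : 0 < τ := pos_of_gt h1
  obtain ⟨⟨z', a⟩, ha⟩ := H.left_lim p τ hτ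
  have hzz : z' = z := (ha.comp Prod.fst).unique hB hτ
  subst hzz
  have hx := h3 τ le_rfl h2
  refine ⟨τ, h1, h2, h3, z', ?_⟩
  by_cases h : a = true ∧ Rings (jump p) τ
  · obtain ⟨rfl, hr⟩ := h
    exact ⟨hr, ha, hx⟩
  · exact absurd ((H.stay p τ z' a hτ ha h).symm.trans hx) hz

lemma exists_hop_out (H : IsRegularPath η₀ lam jump sleep st) {p : Particle η₀} {s t : ℝ≥0}
    {x : V} (hst : s ≤ t) (hs : (st p s).1 = x) (ht : (st p t).1 ≠ x) :
    ∃ τ, s < τ ∧ τ ≤ t ∧ (∀ r, s ≤ r → r < τ → (st p r).1 = x) ∧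
      ∃ z, HopsAt (jump p) (st p) τ x z := by
  obtain ⟨τ, h1, h2, h3, h4⟩ := exists_first_exit (f := fun t => (st p t).1)
    (H.pos_right_cont p) hst hs ht
  have hτ : 0 < τ := pos_of_gt h1
  obtain ⟨⟨z', a⟩, ha⟩ := H.left_lim p τ hτ
  have hzz : z' = x := (ha.comp Prod.fst).unique (before_of_Ico h1 h3) hτ
  subst hzz
  refine ⟨τ, h1, h2, h3, (st p τ).1, ?_⟩
  by_cases h : a = true ∧ Rings (jump p) τ
  · obtain ⟨rfl, hr⟩ := h
    exact ⟨hr, ha, rfl⟩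
  · exact absurd (H.stay p τ z' a hτ ha h) h4

lemma pos_eq_of_jump_eq (H : IsRegularPath η₀ lam jump sleep st) {p : Particle η₀} {s t : ℝ≥0}
    (hst : s ≤ t) (h : jump p t = jump p s) : (st p t).1 = (st p s).1 := by
  by_contra hne
  obtain ⟨τ, h1, h2, -, z, hz⟩ := H.exists_hop_out hst rfl hne
  exact absurd ((hz.1.2 s h1).trans_le (H.jump_mono p h2)) h.not_gt

lemma finite_hops_before (H : IsRegularPath η₀ lam jump sleep st) (y : V) (T : ℝ≥0) :
    {q : Particle η₀ × ℝ≥0 | q.2 ≤ T ∧ Rings (jump q.1) q.2 ∧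
      ∃ s ≤ T, (st q.1 s).1 = y}.Finite := by
  refine ((H.locally_finite y T).biUnion fun p _ =>
    (finite_rings (H.jump_mono p) T).image (Prod.mk p)).subset ?_
  rintro ⟨p, t⟩ ⟨h1, h2, h3⟩
  simp only [Set.mem_iUnion]
  exact ⟨p, h3, t, ⟨h1, h2⟩, rfl⟩

lemma hops_before_finite (H : IsRegularPath η₀ lam jump sleep st) (y : V) (T : ℝ≥0) :
    {q | q ∈ hopsFrom jump st y ∧ q.2 ≤ T}.Finite ∧
      {q | q ∈ hopsTo jump st y ∧ q.2 ≤ T}.Finite := by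
  constructor
  · refine (H.finite_hops_before y T).subset ?_
    rintro ⟨p, t⟩ ⟨⟨z, h1, h2, h3⟩, ht⟩
    refine ⟨ht, h1, ?_⟩
    obtain ⟨l, hl, hlt⟩ := h2.exists_Ioo h1.1
    obtain ⟨s, hs1, hs2⟩ := exists_between hl
    exact ⟨s, hs2.le.trans ht, by rw [hlt s hs1 hs2]⟩
  · refine (H.finite_hops_before y T).subset ?_
    rintro ⟨p, t⟩ ⟨⟨z, h1, h2, h3⟩, ht⟩
    exact ⟨ht, h1, t, ht, h3⟩

/-- If no particle hops from `y` after time `T`, then particles stay at `y`. -/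
lemma stays (H : IsRegularPath η₀ lam jump sleep st) {y : V} {T : ℝ≥0}
    (hT : ∀ q ∈ hopsFrom jump st y, q.2 ≤ T) {p : Particle η₀} {s t : ℝ≥0} (hs : T ≤ s)
    (hst : s ≤ t) (h : (st p s).1 = y) : (st p t).1 = y := by
  by_contra hne
  obtain ⟨τ, h1, -, -, z, hz⟩ := H.exists_hop_out hst h hne
  exact absurd (hT (p, τ) ⟨z, hz⟩) (hs.trans_lt h1).not_ge

/-- If no particle hops from `y` after time `T`, then after that time at most one particle
is at `y`. -/
lemma eq_of_share (H : IsRegularPath η₀ lam jump sleep st) {y : V} {T : ℝ≥0}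
    (hT : ∀ q ∈ hopsFrom jump st y, q.2 ≤ T) {p q : Particle η₀} {t : ℝ≥0} (ht : T ≤ t)
    (hp : (st p t).1 = y) (hq : (st q t).1 = y) : p = q := by
  by_contra hne
  obtain ⟨t', ht'⟩ := H.jump_unbounded p (jump p t + 1)
  obtain ⟨τ, h1, -, h3, -⟩ := exists_ring (H.jump_mono p) (H.jump_right_cont p)
    (Nat.lt_of_succ_le ht')
  have hB : Before (st p) τ (y, true) := by
    refine before_of_Ico h1 fun r hr _ => Prod.ext (H.stays hT ht hr hp) ?_
    refine (H.active p r).2 (Or.inl ⟨q, Ne.symm hne, ?_⟩)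
    rw [H.stays hT ht hr hp, H.stays hT ht hr hq]
  exact absurd (hT (p, τ) ⟨_, h3, hB, rfl⟩) (ht.trans_lt h1).not_ge

lemma exists_time_bound {S : Set (Particle η₀ × ℝ≥0)} (hS : S.Finite) :
    ∃ T, ∀ q ∈ S, q.2 ≤ T := by
  obtain ⟨T, hT⟩ := (hS.image Prod.snd).bddAbove
  exact ⟨T, fun q hq => hT ⟨q, hq, rfl⟩⟩

/-- If finitely many hops from `x` occur, then finitely many hops to `x` occur. -/
theorem finite_hopsTo (H : IsRegularPath η₀ lam jump sleep st) {x : V}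
    (hfin : (hopsFrom jump st x).Finite) : (hopsTo jump st x).Finite := by
  obtain ⟨T, hT⟩ := exists_time_bound hfin
  have hsub : {q | q ∈ hopsTo jump st x ∧ T < q.2}.Subsingleton := by
    have key : ∀ q q', q ∈ hopsTo jump st x → T < q.2 → q' ∈ hopsTo jump st x → T < q'.2 →
        q.2 ≤ q'.2 → q = q' := by
      rintro ⟨p, t⟩ ⟨p', t'⟩ ⟨z, hz⟩ ht ⟨z', hz'⟩ ht' hle
      dsimp only at *
      have hpt := H.stays hT ht.le hle hz.2.2
      have hpp : p = p' := H.eq_of_share hT ht'.le hpt hz'.2.2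
      subst hpp
      rcases hle.eq_or_lt with h | h
      · rw [h]
      · have hB : Before (fun t => (st p t).1) t' x :=
          before_of_Ico h fun r hr _ => H.stays hT ht.le hr hz.2.2
        have hzx : z' = x := (hz'.2.1.comp Prod.fst).unique hB hz'.1.1
        subst hzx
        exact absurd hz' (H.no_self_hop p t' z')
    intro q hq q' hq'
    rcases le_total q.2 q'.2 with h | h
    · exact key q q' hq.1 hq.2 hq'.1 hq'.2 h
    · exact (key q' q hq'.1 hq'.2 hq.1 hq.2 h).symm
  refine ((H.hops_before_finite x T).2.union hsub.finite).subset fun q hq => ?_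
  rcases le_or_gt q.2 T with h | h
  · exact Or.inl ⟨hq, h⟩
  · exact Or.inr ⟨hq, h⟩

/-- If finitely many active visits to `x` occur, then finitely many hops from `x` occur. -/
theorem finite_hopsFrom (H : IsRegularPath η₀ lam jump sleep st) {x : V}
    (hfin : {t | ∃ p z, HopsAt (jump p) (st p) t z x ∧ (st p t).2 = true}.Finite) :
    (hopsFrom jump st x).Finite := by
  obtain ⟨T, hT⟩ := hfin.bddAbove
  have hvis : ∀ p τ z, T < τ → HopsAt (jump p) (st p) τ z x → (st p τ).2 ≠ true :=
    fun p τ z hτ hh ha => absurd (hT ⟨p, z, hh, ha⟩) hτ.not_ge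
  have hstay : ∀ p t, (p, t) ∈ hopsFrom jump st x → T < t →
      ∀ r, T ≤ r → r < t → (st p r).1 = x := by
    rintro p t ⟨z, hz⟩ ht r hr hrt
    by_contra hne
    obtain ⟨l, hl, hlt⟩ := hz.2.1.exists_Ioo hz.1.1
    obtain ⟨s, hs1, hs2⟩ := exists_between (max_lt hl hrt)
    have hs : st p s = (x, true) := hlt s ((le_max_left _ _).trans_lt hs1) hs2
    have hrs : r < s := (le_max_right _ _).trans_lt hs1
    obtain ⟨τ, h1, h2, h3, z', hz'⟩ := H.exists_hop_into hrs.le hne (by rw [hs])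
    have hTτ : T < τ := hr.trans_lt h1
    have hsl := hvis p τ z' hTτ hz'
    rw [Ne, H.active p τ] at hsl
    push Not at hsl
    have hlam : lam = ⊤ := by
      by_contra hlam
      exact (hsl.2 hlam).2.1 z' x hz'
    have hact := (H.active p s).1 (by rw [hs])
    rcases hact with ⟨q, hq, hqs⟩ | ⟨hl', -⟩
    · rw [hs] at hqs
      have hqτ : (st q τ).1 ≠ x := by
        have := hsl.1 q hq
        rwa [h3 τ le_rfl h2] at this
      obtain ⟨σ, g1, g2, g3, w, hw⟩ := H.exists_hop_into h2 hqτ hqs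
      refine hvis q σ w (hTτ.trans g1) hw ((H.active q σ).2 (Or.inl ⟨p, hq.symm, ?_⟩))
      rw [h3 σ g1.le g2, g3 σ le_rfl g2]
    · exact hl' hlam
  have hlate : {q | q ∈ hopsFrom jump st x ∧ T < q.2}.Finite := by
    refine Set.Finite.of_finite_image (f := Prod.fst) ((H.locally_finite x T).subset ?_) ?_
    · rintro _ ⟨⟨p, t⟩, ⟨h1, h2⟩, rfl⟩
      exact ⟨T, le_rfl, hstay p t h1 h2 T le_rfl h2⟩
    · have key : ∀ p t t', (p, t) ∈ hopsFrom jump st x → (p, t') ∈ hopsFrom jump st x → T < t →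
          t < t' → False := by
        rintro p t t' ⟨z, hz⟩ h' ht htt
        have hx := hstay p t' h' (ht.trans htt) t ht.le htt
        have hzx : z = x := hz.2.2.symm.trans hx
        subst hzx
        exact H.no_self_hop p t z hz
      rintro ⟨p, t⟩ ⟨h1, h2⟩ ⟨p', t'⟩ ⟨h1', h2'⟩ heq
      dsimp only at heq h2 h2'
      subst heq
      rcases lt_trichotomy t t' with h | h | h
      · exact (key p t t' h1 h1' h2 h).elim
      · rw [h]
      · exact (key p t' t h1' h1 h2' h).elim
  refine ((H.hops_before_finite x T).1.union hlate).subset fun q hq => ?_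
  rcases le_or_gt q.2 T with h | h
  · exact Or.inl ⟨hq, h⟩
  · exact Or.inr ⟨hq, h⟩

/-- If finitely many hops from each vertex of a finite set occur, then eventually at most one
particle is at each of these vertices. -/
theorem exists_time_alone (H : IsRegularPath η₀ lam jump sleep st) (s : Finset V)
    (hfin : ∀ y ∈ s, (hopsFrom jump st y).Finite) :
    ∃ T, ∀ t, T ≤ t → ∀ p q, (st p t).1 ∈ s → (st p t).1 = (st q t).1 → p = q := by
  obtain ⟨T, hT⟩ := exists_time_bound (s.finite_toSet.biUnion hfin)
  refine ⟨T, fun t ht p q hp hpq => ?_⟩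
  refine H.eq_of_share (y := (st p t).1) (fun r hr => hT r ?_) ht rfl hpq.symm
  simp only [Set.mem_iUnion]
  exact ⟨_, hp, hr⟩

end IsRegularPath

/-! ### Estimates for Poisson clocks -/

lemma poissonMeasure_one_le (r : ℝ≥0) : poissonMeasure r {n | 1 ≤ n} ≤ ENNReal.ofReal r := by
  have h1 : {n : ℕ | 1 ≤ n} = {0}ᶜ := by ext n; simp [Nat.one_le_iff_ne_zero]
  rw [← ENNReal.ofReal_toReal (measure_ne_top (poissonMeasure r) _)]
  refine ENNReal.ofReal_le_ofReal ?_
  change (poissonMeasure r).real _ ≤ _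
  rw [h1, probReal_compl_eq_one_sub (measurableSet_singleton 0), poissonMeasure_real_singleton]
  have := Real.add_one_le_exp (-(r : ℝ))
  simp
  linarith

lemma poissonMeasure_two_le (r : ℝ≥0) :
    poissonMeasure r {n | 2 ≤ n} ≤ ENNReal.ofReal ((r : ℝ) ^ 2) := by
  have h1 : {n : ℕ | 2 ≤ n} = ({0} ∪ {1})ᶜ := by ext n; simp; omega
  rw [← ENNReal.ofReal_toReal (measure_ne_top (poissonMeasure r) _)]
  refine ENNReal.ofReal_le_ofReal ?_
  change (poissonMeasure r).real _ ≤ _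
  rw [h1, probReal_compl_eq_one_sub (by measurability),
    measureReal_union (by simp) (measurableSet_singleton 1), poissonMeasure_real_singleton,
    poissonMeasure_real_singleton]
  have := Real.add_one_le_exp (-(r : ℝ))
  have hr : (0 : ℝ) ≤ r := r.2
  simp
  nlinarith

lemma tendsto_poissonMeasure_Iio (k : ℕ) :
    Tendsto (fun n : ℕ => (poissonMeasure (n : ℝ≥0)).real (Set.Iio k)) atTop (𝓝 0) := by
  have h1 : ∀ n : ℕ, (poissonMeasure (n : ℝ≥0)).real (Set.Iio k)
      = ∑ j ∈ Finset.range k, (n : ℝ) ^ j * Real.exp (-n) / (j.factorial : ℝ) := by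
    intro n
    have e : (Set.Iio k : Set ℕ) = (Finset.range k : Set ℕ) := by ext; simp
    rw [e, ← sum_measureReal_singleton]
    refine Finset.sum_congr rfl fun j _ => ?_
    rw [poissonMeasure_real_singleton]
    simp [mul_comm]
  simp only [h1]
  have h2 : ∀ j ∈ Finset.range k, Tendsto
      (fun n : ℕ => (n : ℝ) ^ j * Real.exp (-n) / (j.factorial : ℝ)) atTop (𝓝 0) := by
    intro j _
    have := ((Real.tendsto_pow_mul_exp_neg_atTop_nhds_zero j).comp
      tendsto_natCast_atTop_atTop).div_const (j.factorial : ℝ)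
    simpa using this
  simpa using tendsto_finsetSum _ h2

namespace ARW

variable {V : Type u} {K : V → V → ℝ} {η₀ : V → ℕ} {lam : ℝ≥0∞} {Ω : Type w}
  {m : MeasurableSpace Ω} {μ : Measure Ω}

/-- The number of rings up to time `t` of the jump clock of the particle `p`. -/
def jumps (Z : ARW K η₀ lam μ) (p : Particle η₀) (t : ℝ≥0) (ω : Ω) : ℕ := Z.clock (Sum.inl p) t ω

/-- The position of the particle `p` at time `t`. -/
def pos (Z : ARW K η₀ lam μ) (p : Particle η₀) (t : ℝ≥0) (ω : Ω) : V := (Z.state p t ω).1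

/-- The trajectory of the configuration `ω` is regular. -/
def Regular (Z : ARW K η₀ lam μ) (ω : Ω) : Prop :=
  IsRegularPath η₀ lam (fun p t => Z.clock (Sum.inl p) t ω)
    (fun p t => Z.clock (Sum.inr p) t ω) (fun p t => Z.state p t ω)

lemma jumps_mono (Z : ARW K η₀ lam μ) (p : Particle η₀) (ω : Ω) :
    Monotone fun t => Z.jumps p t ω :=
  Z.poisson.mono (Sum.inl p) ω

lemma measurable_jumps (Z : ARW K η₀ lam μ) (p : Particle η₀) (t : ℝ≥0) :
    Measurable[Z.ℱ t] (Z.jumps p t) :=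
  Z.poisson.adapted (Sum.inl p) t

lemma measurable_jumps' (Z : ARW K η₀ lam μ) (p : Particle η₀) (t : ℝ≥0) :
    Measurable (Z.jumps p t) :=
  (Z.measurable_jumps p t).mono (Z.ℱ.le t) le_rfl

lemma measurable_jumps_sub (Z : ARW K η₀ lam μ) (p : Particle η₀) (s t : ℝ≥0) :
    Measurable fun ω => Z.clock (Sum.inl p) t ω - Z.clock (Sum.inl p) s ω :=
  (Z.measurable_jumps' p t).sub (Z.measurable_jumps' p s)

lemma measurableSet_pos (Z : ARW K η₀ lam μ) (p : Particle η₀) (t : ℝ≥0) (y : V) :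
    MeasurableSet[Z.ℱ t] {ω | Z.pos p t ω = y} := by
  have h : {ω | Z.pos p t ω = y} = {ω | Z.state p t ω = (y, true)} ∪
      {ω | Z.state p t ω = (y, false)} := by
    ext ω
    simp only [pos, Set.mem_ofPred_eq, Set.mem_union, Prod.ext_iff]
    cases (Z.state p t ω).2 <;> simp
  rw [h]
  exact (Z.adapted p t _).union (Z.adapted p t _)

lemma measure_two_rings_le (Z : ARW K η₀ lam μ) (p : Particle η₀) {s t : ℝ≥0} (hst : s ≤ t) :
    μ {ω | Z.jumps p s ω + 2 ≤ Z.jumps p t ω} ≤ ENNReal.ofReal (((t - s : ℝ≥0) : ℝ) ^ 2) := by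
  have h := Z.poisson.law (Sum.inl p) s t hst
  have h2 := poissonMeasure_two_le (1 * (t - s))
  simp only [Sum.elim_inl] at h
  rw [← h, Measure.map_apply (Z.measurable_jumps_sub p s t)
    (by measurability), one_mul] at h2
  refine (measure_mono fun ω hω => ?_).trans h2
  simp only [jumps, Set.mem_ofPred_eq, Set.mem_preimage] at hω ⊢
  omega

lemma measure_ring_le (Z : ARW K η₀ lam μ) (p : Particle η₀) {s t : ℝ≥0} (hst : s ≤ t) :
    μ ((fun ω => Z.clock (Sum.inl p) t ω - Z.clock (Sum.inl p) s ω) ⁻¹' {n | 1 ≤ n})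
      ≤ ENNReal.ofReal ((t - s : ℝ≥0) : ℝ) := by
  have h := Z.poisson.law (Sum.inl p) s t hst
  have h2 := poissonMeasure_one_le (1 * (t - s))
  simp only [Sum.elim_inl] at h
  rwa [← h, Measure.map_apply (Z.measurable_jumps_sub p s t)
    (by measurability), one_mul] at h2

lemma measure_both_ring_le (Z : ARW K η₀ lam μ) {p q : Particle η₀} (hpq : p ≠ q) {s t : ℝ≥0}
    (hst : s ≤ t) :
    μ {ω | Z.jumps p s ω < Z.jumps p t ω ∧ Z.jumps q s ω < Z.jumps q t ω}
      ≤ ENNReal.ofReal (((t - s : ℝ≥0) : ℝ) ^ 2) := by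
  have hind := (Z.poisson.indep s t hst).indep
    (show (some (Sum.inl p) : Option (Particle η₀ ⊕ Particle η₀)) ≠ some (Sum.inl q) by
      simpa using hpq)
  have h2 := (Indep_iff _ _ μ).1 hind
    ((fun ω => Z.clock (Sum.inl p) t ω - Z.clock (Sum.inl p) s ω) ⁻¹' {n | 1 ≤ n})
    ((fun ω => Z.clock (Sum.inl q) t ω - Z.clock (Sum.inl q) s ω) ⁻¹' {n | 1 ≤ n})
    ⟨_, trivial, rfl⟩ ⟨_, trivial, rfl⟩
  calc μ {ω | Z.jumps p s ω < Z.jumps p t ω ∧ Z.jumps q s ω < Z.jumps q t ω}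
      ≤ μ (((fun ω => Z.clock (Sum.inl p) t ω - Z.clock (Sum.inl p) s ω) ⁻¹' {n | 1 ≤ n}) ∩
          ((fun ω => Z.clock (Sum.inl q) t ω - Z.clock (Sum.inl q) s ω) ⁻¹' {n | 1 ≤ n})) := by
        refine measure_mono fun ω hω => ?_
        simp only [jumps, Set.mem_ofPred_eq, Set.mem_inter_iff, Set.mem_preimage] at hω ⊢
        omega
    _ ≤ ENNReal.ofReal ((t - s : ℝ≥0) : ℝ) * ENNReal.ofReal ((t - s : ℝ≥0) : ℝ) := by
        rw [h2]
        exact mul_le_mul' (Z.measure_ring_le p hst) (Z.measure_ring_le q hst)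
    _ = _ := by rw [← ENNReal.ofReal_mul (NNReal.coe_nonneg _), sq]

lemma ae_jumps_unbounded [IsProbabilityMeasure μ] (Z : ARW K η₀ lam μ) (p : Particle η₀)
    (k : ℕ) : ∀ᵐ ω ∂μ, ∃ t, k ≤ Z.jumps p t ω := by
  have h1 : ∀ n : ℕ, μ.real {ω | ¬ ∃ t, k ≤ Z.jumps p t ω}
      ≤ (poissonMeasure (n : ℝ≥0)).real (Set.Iio k) := by
    intro n
    have h := Z.poisson.law (Sum.inl p) 0 n zero_le
    simp only [Sum.elim_inl, tsub_zero, one_mul] at h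
    rw [← h, map_measureReal_apply
      (Z.measurable_jumps_sub p 0 n) (by measurability)]
    refine measureReal_mono fun ω hω => ?_
    simp only [Set.mem_ofPred_eq, not_exists, not_le] at hω
    have := hω n
    simp only [jumps, Set.mem_preimage, Set.mem_Iio] at this ⊢
    omega
  have h2 := ge_of_tendsto' (tendsto_poissonMeasure_Iio k) h1
  rw [ae_iff]
  exact (measureReal_eq_zero_iff).1 (le_antisymm h2 measureReal_nonneg)

lemma ae_no_self_hop [Countable V] [IsProbabilityMeasure μ] (Z : ARW K η₀ lam μ)
    (hK : ∀ y, K y y = 0) : ∀ᵐ ω ∂μ, ∀ p t y,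
      ¬ HopsAt (fun t => Z.clock (Sum.inl p) t ω) (fun t => Z.state p t ω) t y y := by
  have h1 : ∀ᵐ ω ∂μ, ∀ (p : Particle η₀) (y : V) (n : ℕ), ¬ ∃ t > 0, Z.clock (Sum.inl p) t ω = n ∧
      HopsAt (fun t => Z.clock (Sum.inl p) t ω) (fun t => Z.state p t ω) t y y := by
    rw [ae_all_iff]; intro p
    rw [ae_all_iff]; intro y
    rw [ae_all_iff]; intro n
    have h := Z.hop_law p n y y 0 Set.univ MeasurableSet.univ
    rw [hK, zero_mul, Set.univ_inter] at h
    rw [ae_iff]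
    simpa only [not_not] using (measureReal_eq_zero_iff).1 h
  filter_upwards [h1] with ω hω p t y hh
  exact hω p y _ ⟨t, hh.1.1, rfl, hh⟩

theorem ae_regular [Countable V] [IsProbabilityMeasure μ] (Z : ARW K η₀ lam μ)
    (hK : ∀ y, K y y = 0) : ∀ᵐ ω ∂μ, Z.Regular ω := by
  have h1 : ∀ᵐ ω ∂μ, ∀ (p : Particle η₀) (k : ℕ), ∃ t, k ≤ Z.jumps p t ω := by
    rw [ae_all_iff]; intro p
    rw [ae_all_iff]; intro k
    exact Z.ae_jumps_unbounded p k
  filter_upwards [Z.path, h1, Z.ae_no_self_hop hK] with ω hpath hunb hself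
  exact ⟨hpath, fun p => Z.poisson.mono _ ω, fun p => Z.poisson.right_cont _ ω, hunb, hself⟩

/-! ### The law of the first hop in a time window -/

/-- The particle `p` hops from `y` to `z` at the first ring of its clock in `(s, t]`. -/
def windowHop (Z : ARW K η₀ lam μ) (p : Particle η₀) (s t : ℝ≥0) (y z : V) : Set Ω :=
  {ω | ∃ τ, s < τ ∧ τ ≤ t ∧ Z.jumps p τ ω = Z.jumps p s ω + 1 ∧
    HopsAt (fun t => Z.clock (Sum.inl p) t ω) (fun t => Z.state p t ω) τ y z}

/-- The particle `p` hops from `y` at the first ring of its clock in `(s, t]`. -/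
def windowHopFrom (Z : ARW K η₀ lam μ) (p : Particle η₀) (s t : ℝ≥0) (y : V) : Set Ω :=
  {ω | ∃ τ, s < τ ∧ τ ≤ t ∧ Z.jumps p τ ω = Z.jumps p s ω + 1 ∧
    ∃ z, HopsAt (fun t => Z.clock (Sum.inl p) t ω) (fun t => Z.state p t ω) τ y z}

/-- Splitting an event about the ring number `n + 1` after time `s` according to whether
this ring occurs by time `t`. -/
lemma measureReal_window [IsProbabilityMeasure μ] (Z : ARW K η₀ lam μ) (p : Particle η₀) (n : ℕ)
    {s t : ℝ≥0} (hst : s ≤ t) (A : Set Ω) (hA : A ⊆ {ω | Z.jumps p s ω = n})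
    (Q : ℝ≥0 → Ω → Prop) (hQ : ∀ τ ω, Q τ ω → Rings (fun t => Z.clock (Sum.inl p) t ω) τ) :
    μ.real (A ∩ {ω | ∃ τ > s, Z.clock (Sum.inl p) τ ω = n + 1 ∧ Q τ ω}) =
      μ.real ((A ∩ {ω | Z.jumps p t ω ≤ n}) ∩
        {ω | ∃ τ > t, Z.clock (Sum.inl p) τ ω = n + 1 ∧ Q τ ω}) +
      μ.real (A ∩ {ω | ∃ τ, s < τ ∧ τ ≤ t ∧ Z.jumps p τ ω = Z.jumps p s ω + 1 ∧ Q τ ω}) := by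
  have hm : MeasurableSet {ω | Z.jumps p t ω ≤ n} :=
    Z.measurable_jumps' p t (measurableSet_Iic (a := n))
  rw [← measureReal_inter_add_sdiff (s := A ∩ {ω | ∃ τ > s, Z.clock (Sum.inl p) τ ω = n + 1 ∧
    Q τ ω}) hm]
  congr 2
  · ext ω
    constructor
    · rintro ⟨⟨h1, τ, h2, h3, h4⟩, h5⟩
      refine ⟨⟨h1, h5⟩, τ, ?_, h3, h4⟩
      by_contra hle
      have h6 : Z.jumps p τ ω ≤ Z.jumps p t ω := Z.jumps_mono p ω (not_lt.1 hle)
      simp only [jumps, Set.mem_ofPred_eq] at h6 h5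
      omega
    · rintro ⟨⟨h1, h5⟩, τ, h2, h3, h4⟩
      exact ⟨⟨h1, τ, hst.trans_lt h2, h3, h4⟩, h5⟩
  · ext ω
    constructor
    · rintro ⟨⟨h1, τ, h2, h3, h4⟩, h5⟩
      have h6 := hA h1
      simp only [Set.mem_ofPred_eq, not_le] at h5 h6
      refine ⟨h1, τ, h2, ?_, by rw [h6]; exact h3, h4⟩
      by_contra hle
      have := (hQ τ ω h4).2 t (not_le.1 hle)
      simp only [jumps] at *
      omega
    · rintro ⟨h1, τ, h2, h3, h4, h5⟩
      have h6 := hA h1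
      simp only [Set.mem_ofPred_eq] at h6
      refine ⟨⟨h1, τ, h2, by rw [← h6]; exact h4, h5⟩, ?_⟩
      simp only [Set.mem_ofPred_eq, not_le]
      have : Z.jumps p τ ω ≤ Z.jumps p t ω := Z.jumps_mono p ω h3
      omega

lemma measureReal_windowHop [IsProbabilityMeasure μ] (Z : ARW K η₀ lam μ) (p : Particle η₀)
    (n : ℕ) {s t : ℝ≥0} (hst : s ≤ t) (y z : V) (A : Set Ω) (hA : MeasurableSet[Z.ℱ s] A)
    (hAn : A ⊆ {ω | Z.jumps p s ω = n}) :
    μ.real (A ∩ Z.windowHop p s t y z) = K y z * μ.real (A ∩ Z.windowHopFrom p s t y) := by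
  have h1 := Z.measureReal_window p n hst A hAn (fun τ ω => HopsAt
    (fun t => Z.clock (Sum.inl p) t ω) (fun t => Z.state p t ω) τ y z) fun τ ω h => h.1
  have h2 := Z.measureReal_window p n hst A hAn (fun τ ω => ∃ z, HopsAt
    (fun t => Z.clock (Sum.inl p) t ω) (fun t => Z.state p t ω) τ y z) fun τ ω h => h.choose_spec.1
  have hA' : MeasurableSet[Z.ℱ t] (A ∩ {ω | Z.jumps p t ω ≤ n}) :=
    (Z.ℱ.mono hst _ hA).inter (Z.measurable_jumps p t (measurableSet_Iic (a := n)))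
  have h3 := Z.hop_law p (n + 1) y z s A hA
  have h4 := Z.hop_law p (n + 1) y z t _ hA'
  rw [h1, h2, h4] at h3
  rw [windowHop, windowHopFrom]
  linarith

lemma measure_windowHop [IsProbabilityMeasure μ] (Z : ARW K η₀ lam μ) (hK : ∀ y z, 0 ≤ K y z)
    (p : Particle η₀) {s t : ℝ≥0} (hst : s ≤ t) (y z : V) (A : Set Ω)
    (hA : MeasurableSet[Z.ℱ s] A) :
    μ (A ∩ Z.windowHop p s t y z) = ENNReal.ofReal (K y z) * μ (A ∩ Z.windowHopFrom p s t y) := by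
  have hmeas : ∀ n, MeasurableSet[Z.ℱ s] (A ∩ {ω | Z.jumps p s ω = n}) := fun n =>
    hA.inter (Z.measurable_jumps p s (measurableSet_singleton n))
  have hdecomp : ∀ D : Set Ω, μ (A ∩ D) = ∑' n, μ ((A ∩ {ω | Z.jumps p s ω = n}) ∩ D) := by
    intro D
    have hU : A = ⋃ n, A ∩ {ω | Z.jumps p s ω = n} := by ext ω; simp
    have h1 := measure_iUnion (μ := μ.restrict D) (f := fun n => A ∩ {ω | Z.jumps p s ω = n})
      (fun i j hij => Set.disjoint_left.2 fun ω h1 h2 => hij (h1.2.symm.trans h2.2))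
      (fun n => Z.ℱ.le s _ (hmeas n))
    rw [← hU, Measure.restrict_apply (Z.ℱ.le s _ hA)] at h1
    rw [h1]
    exact tsum_congr fun n => Measure.restrict_apply (Z.ℱ.le s _ (hmeas n))
  rw [hdecomp, hdecomp (Z.windowHopFrom p s t y), ← ENNReal.tsum_mul_left]
  refine tsum_congr fun n => ?_
  have h := Z.measureReal_windowHop p n hst y z _ (hmeas n) Set.inter_subset_right
  rw [← ENNReal.ofReal_toReal (measure_ne_top μ (A ∩ {ω | Z.jumps p s ω = n} ∩
    Z.windowHop p s t y z)), ← ENNReal.ofReal_toReal (measure_ne_top μ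
    (A ∩ {ω | Z.jumps p s ω = n} ∩ Z.windowHopFrom p s t y)), ← ENNReal.ofReal_mul (hK y z)]
  exact congrArg ENNReal.ofReal h

lemma lintegral_windowHop [IsProbabilityMeasure μ] (Z : ARW K η₀ lam μ) (hK : ∀ y z, 0 ≤ K y z)
    (p : Particle η₀) {s t : ℝ≥0} (hst : s ≤ t) (y z : V) (W : Ω → ℝ≥0∞)
    (hW : Measurable[Z.ℱ s] W) :
    ∫⁻ ω in Z.windowHop p s t y z, W ω ∂μ
      = ENNReal.ofReal (K y z) * ∫⁻ ω in Z.windowHopFrom p s t y, W ω ∂μ := by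
  rw [← lintegral_trim (Z.ℱ.le s) hW, ← lintegral_trim (Z.ℱ.le s) hW, ← smul_eq_mul,
    ← lintegral_smul_measure]
  congr 1
  refine @Measure.ext _ (Z.ℱ s) _ _ fun A hA => ?_
  rw [Measure.smul_apply, trim_measurableSet_eq _ hA, trim_measurableSet_eq _ hA,
    Measure.restrict_apply (Z.ℱ.le s _ hA), Measure.restrict_apply (Z.ℱ.le s _ hA),
    Z.measure_windowHop hK p hst y z A hA, smul_eq_mul]

end ARW

/-! ### Multiplicative functionals along a time grid -/

lemma IsRegularPath.windowHop_of_ne {V : Type u} {η₀ : V → ℕ} {lam : ℝ≥0∞}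
    {jump sleep : Particle η₀ → ℝ≥0 → ℕ} {st : Particle η₀ → ℝ≥0 → V × Bool}
    (H : IsRegularPath η₀ lam jump sleep st) {p : Particle η₀} {s t : ℝ≥0} (hst : s ≤ t)
    (hne : (st p s).1 ≠ (st p t).1) (h2 : jump p t < jump p s + 2) :
    ∃ τ, s < τ ∧ τ ≤ t ∧ jump p τ = jump p s + 1 ∧
      HopsAt (jump p) (st p) τ (st p s).1 (st p t).1 := by
  obtain ⟨τ, h3, h4, -, z, hz⟩ := H.exists_hop_out hst rfl hne.symm
  have h5 := hz.1.2 s h3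
  have h6 := H.jump_mono p h4
  have h7 : jump p t = jump p τ := by omega
  have h8 := H.pos_eq_of_jump_eq h4 h7
  have h9 : z = (st p t).1 := by rw [h8]; exact hz.2.2.symm
  exact ⟨τ, h3, h4, by omega, h9 ▸ hz⟩

lemma IsRegularPath.ne_of_windowHop {V : Type u} {η₀ : V → ℕ} {lam : ℝ≥0∞}
    {jump sleep : Particle η₀ → ℝ≥0 → ℕ} {st : Particle η₀ → ℝ≥0 → V × Bool}
    (H : IsRegularPath η₀ lam jump sleep st) {p : Particle η₀} {s t τ : ℝ≥0} {y z : V}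
    (h1 : s < τ) (h3 : τ ≤ t) (h4 : jump p τ = jump p s + 1) (hz : HopsAt (jump p) (st p) τ y z)
    (h2 : jump p t < jump p s + 2) : (st p s).1 ≠ (st p t).1 := by
  have h6 := H.jump_mono p h3
  have h8 : (st p t).1 = z := (H.pos_eq_of_jump_eq h3 (by omega)).trans hz.2.2
  have hB : Before (fun r => (st p r).1) τ (st p s).1 := by
    refine before_of_Ico h1 fun r hr hrτ => H.pos_eq_of_jump_eq hr ?_
    have := hz.1.2 r hrτ
    have := H.jump_mono p hr
    omega
  have h9 : (st p s).1 = y := hB.unique (hz.2.1.comp Prod.fst) hz.1.1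
  rw [h8, h9]
  rintro rfl
  exact H.no_self_hop p τ y hz

namespace ARW

variable {V : Type u} {K : V → V → ℝ} {η₀ : V → ℕ} {lam : ℝ≥0∞} {Ω : Type w}
  {m : MeasurableSpace Ω} {μ : Measure Ω}

lemma measurable_comp_pos [Countable V] (Z : ARW K η₀ lam μ) (p : Particle η₀) {s t : ℝ≥0}
    (hst : s ≤ t) {β : Type v} [MeasurableSpace β] (φ : V → V → β) :
    Measurable[Z.ℱ t] fun ω => φ (Z.pos p s ω) (Z.pos p t ω) := by
  let : MeasurableSpace (V × V) := ⊤
  have h : Measurable[Z.ℱ t] fun ω => (Z.pos p s ω, Z.pos p t ω) := by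
    refine @measurable_to_countable' _ _ _ _ (Z.ℱ t) _ fun a => ?_
    have : (fun ω => (Z.pos p s ω, Z.pos p t ω)) ⁻¹' {a}
        = {ω | Z.pos p s ω = a.1} ∩ {ω | Z.pos p t ω = a.2} := by
      ext ω; simp [Prod.ext_iff]
    rw [this]
    exact (Z.ℱ.mono hst _ (Z.measurableSet_pos p s _)).inter (Z.measurableSet_pos p t _)
  exact (measurable_from_top (f := fun a : V × V => φ a.1 a.2)).comp h

/-- The event that the particle `p` is at different vertices at times `s` and `t`. -/
def moved (Z : ARW K η₀ lam μ) (p : Particle η₀) (s t : ℝ≥0) : Set Ω :=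
  {ω | Z.pos p s ω ≠ Z.pos p t ω}

lemma measurableSet_moved [Countable V] (Z : ARW K η₀ lam μ) (p : Particle η₀) {s t : ℝ≥0}
    (hst : s ≤ t) : MeasurableSet (Z.moved p s t) := by
  have h := (Z.measurable_comp_pos p hst (fun y z => y ≠ z)).mono (Z.ℱ.le t) le_rfl
  exact measurableSet_setOfPred.2 h

lemma lintegral_moved_le [Countable V] [IsProbabilityMeasure μ] (Z : ARW K η₀ lam μ)
    (hK : ∀ y z, 0 ≤ K y z) (hKs : ∀ y, K y y = 0) (φ : V → V → ℝ≥0∞) (M C : ℝ≥0∞)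
    (hM : ∀ y z, φ y z ≤ M) (hφ : ∀ y, ∑' z, ENNReal.ofReal (K y z) * φ y z ≤ 1)
    (p : Particle η₀) {s t : ℝ≥0} (hst : s ≤ t) (W : Ω → ℝ≥0∞) (hW : Measurable[Z.ℱ s] W)
    (hC : ∀ ω, W ω ≤ C) :
    ∫⁻ ω in Z.moved p s t, W ω * φ (Z.pos p s ω) (Z.pos p t ω) ∂μ ≤
      ∫⁻ ω in Z.moved p s t, W ω ∂μ +
        (C * M + C) * ENNReal.ofReal (((t - s : ℝ≥0) : ℝ) ^ 2) := by
  classical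
  have hreg := Z.ae_regular hKs
  have hWm : Measurable W := hW.mono (Z.ℱ.le s) le_rfl
  set δ := ENNReal.ofReal (((t - s : ℝ≥0) : ℝ) ^ 2) with hδ
  set O : Set Ω := {ω | Z.jumps p t ω < Z.jumps p s ω + 2} with hO
  have hOm : MeasurableSet O :=
    measurableSet_lt (Z.measurable_jumps' p t) ((Z.measurable_jumps' p s).add_const 2)
  have hOc : μ Oᶜ ≤ δ := by
    refine le_trans (measure_mono fun ω hω => ?_) (Z.measure_two_rings_le p hst)
    simpa [hO] using hω
  have hmov := Z.measurableSet_moved p hst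
  set mv := Z.moved p s t with hmv
  set A : V → Set Ω := fun y => {ω | Z.pos p s ω = y} with hA
  have hAs : ∀ y, MeasurableSet[Z.ℱ s] (A y) := fun y => Z.measurableSet_pos p s y
  have hAm : ∀ y, MeasurableSet (A y) := fun y => Z.ℱ.le s _ (hAs y)
  have hAd : Pairwise (Function.onFun Disjoint A) := fun y z hyz =>
    Set.disjoint_left.2 fun ω h1 h2 => hyz (h1.symm.trans h2)
  have hTm : ∀ z, MeasurableSet {ω | Z.pos p t ω = z} := fun z =>
    Z.ℱ.le t _ (Z.measurableSet_pos p t z)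
  have hdis : ∀ B : Set Ω, MeasurableSet B →
      ∑' y, ∫⁻ ω in A y ∩ B, W ω ∂μ = ∫⁻ ω in B, W ω ∂μ := by
    intro B hB
    have hU : B = ⋃ y, A y ∩ B := by ext ω; simp [hA]
    conv_rhs => rw [hU]
    exact (lintegral_iUnion (fun y => (hAm y).inter hB) (fun y z hyz =>
      (hAd hyz).mono Set.inter_subset_left Set.inter_subset_left) _).symm
  have hbad : ∫⁻ ω in mv \ O, W ω * φ (Z.pos p s ω) (Z.pos p t ω) ∂μ ≤ C * M * δ :=
    calc ∫⁻ ω in mv \ O, W ω * φ (Z.pos p s ω) (Z.pos p t ω) ∂μ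
        ≤ ∫⁻ _ in mv \ O, C * M ∂μ := lintegral_mono fun ω => mul_le_mul' (hC ω) (hM _ _)
      _ = C * M * μ (mv \ O) := setLIntegral_const _ _
      _ ≤ C * M * δ := mul_le_mul_right ((measure_mono fun ω h => h.2).trans hOc) _
  have hcond : ∀ y, ∀ B, ∫⁻ ω in A y ∩ B, W ω ∂μ = ∫⁻ ω in B, (A y).indicator W ω ∂μ := by
    intro y B
    rw [lintegral_indicator (hAm y), Measure.restrict_restrict (hAm y)]
  have hR : ∀ y z, ∫⁻ ω in A y ∩ {ω | Z.pos p t ω = z} ∩ (mv ∩ O),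
      W ω * φ (Z.pos p s ω) (Z.pos p t ω) ∂μ
      ≤ ENNReal.ofReal (K y z) * φ y z * ∫⁻ ω in A y ∩ Z.windowHopFrom p s t y, W ω ∂μ := by
    intro y z
    have hRm : MeasurableSet (A y ∩ {ω | Z.pos p t ω = z} ∩ (mv ∩ O)) :=
      ((hAm y).inter (hTm z)).inter (hmov.inter hOm)
    calc ∫⁻ ω in A y ∩ {ω | Z.pos p t ω = z} ∩ (mv ∩ O),
          W ω * φ (Z.pos p s ω) (Z.pos p t ω) ∂μ
        = ∫⁻ ω in A y ∩ {ω | Z.pos p t ω = z} ∩ (mv ∩ O), W ω * φ y z ∂μ := by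
          refine setLIntegral_congr_fun hRm fun ω hω => ?_
          have h1 : Z.pos p s ω = y := hω.1.1
          have h2 : Z.pos p t ω = z := hω.1.2
          simp only [h1, h2]
      _ = (∫⁻ ω in A y ∩ {ω | Z.pos p t ω = z} ∩ (mv ∩ O), W ω ∂μ) * φ y z :=
          lintegral_mul_const _ hWm
      _ ≤ (∫⁻ ω in A y ∩ Z.windowHop p s t y z, W ω ∂μ) * φ y z := by
          refine mul_le_mul_left (lintegral_mono_set' ?_) _
          filter_upwards [hreg] with ω hω hmem
          obtain ⟨⟨h1, h2⟩, h3, h4⟩ := hmem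
          refine ⟨h1, ?_⟩
          have h5 := IsRegularPath.windowHop_of_ne hω hst h3 h4
          have h1' : (Z.state p s ω).1 = y := h1
          have h2' : (Z.state p t ω).1 = z := h2
          rw [h1', h2'] at h5
          exact h5
      _ = ENNReal.ofReal (K y z) * φ y z * ∫⁻ ω in A y ∩ Z.windowHopFrom p s t y, W ω ∂μ := by
          rw [hcond, hcond, Z.lintegral_windowHop hK p hst y z _ (hW.indicator (hAs y))]
          ring
  have hI : ∀ y, ∫⁻ ω in A y ∩ Z.windowHopFrom p s t y, W ω ∂μ
      ≤ ∫⁻ ω in A y ∩ (mv ∩ O), W ω ∂μ + ∫⁻ ω in A y ∩ Oᶜ, W ω ∂μ := by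
    intro y
    rw [← lintegral_inter_add_sdiff W (A y ∩ Z.windowHopFrom p s t y) hOm]
    refine add_le_add (lintegral_mono_set' ?_) (lintegral_mono_set fun ω h => ⟨h.1.1, h.2⟩)
    filter_upwards [hreg] with ω hω hmem
    obtain ⟨⟨h1, τ, h2, h3, h4, z, hz⟩, h5⟩ := hmem
    exact ⟨h1, IsRegularPath.ne_of_windowHop hω h2 h3 h4 hz h5, h5⟩
  have hgood : ∫⁻ ω in mv ∩ O, W ω * φ (Z.pos p s ω) (Z.pos p t ω) ∂μ
      ≤ ∫⁻ ω in mv ∩ O, W ω ∂μ + C * δ := by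
    have hcov : mv ∩ O ⊆ ⋃ a : V × V, A a.1 ∩ {ω | Z.pos p t ω = a.2} ∩ (mv ∩ O) := by
      intro ω hω
      simp only [Set.mem_iUnion]
      exact ⟨(Z.pos p s ω, Z.pos p t ω), ⟨rfl, rfl⟩, hω⟩
    calc ∫⁻ ω in mv ∩ O, W ω * φ (Z.pos p s ω) (Z.pos p t ω) ∂μ
        ≤ ∑' a : V × V, ∫⁻ ω in A a.1 ∩ {ω | Z.pos p t ω = a.2} ∩ (mv ∩ O),
            W ω * φ (Z.pos p s ω) (Z.pos p t ω) ∂μ :=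
          (lintegral_mono_set hcov).trans (lintegral_iUnion_le _ _)
      _ ≤ ∑' a : V × V, ENNReal.ofReal (K a.1 a.2) * φ a.1 a.2 *
            ∫⁻ ω in A a.1 ∩ Z.windowHopFrom p s t a.1, W ω ∂μ :=
          ENNReal.tsum_le_tsum fun a => hR a.1 a.2
      _ = ∑' y, (∑' z, ENNReal.ofReal (K y z) * φ y z) *
            ∫⁻ ω in A y ∩ Z.windowHopFrom p s t y, W ω ∂μ := by
          rw [ENNReal.tsum_prod']
          exact tsum_congr fun y => by rw [← ENNReal.tsum_mul_right]
      _ ≤ ∑' y, (∫⁻ ω in A y ∩ (mv ∩ O), W ω ∂μ + ∫⁻ ω in A y ∩ Oᶜ, W ω ∂μ) :=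
          ENNReal.tsum_le_tsum fun y => (mul_le_of_le_one_left' (hφ y)).trans (hI y)
      _ = ∫⁻ ω in mv ∩ O, W ω ∂μ + ∫⁻ ω in Oᶜ, W ω ∂μ := by
          rw [ENNReal.tsum_add, hdis _ (hmov.inter hOm), hdis _ hOm.compl]
      _ ≤ ∫⁻ ω in mv ∩ O, W ω ∂μ + C * δ := by
          refine add_le_add_right ?_ _
          calc ∫⁻ ω in Oᶜ, W ω ∂μ ≤ ∫⁻ _ in Oᶜ, C ∂μ := lintegral_mono hC
            _ = C * μ Oᶜ := setLIntegral_const _ _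
            _ ≤ C * δ := mul_le_mul_right hOc _
  rw [← lintegral_inter_add_sdiff _ mv hOm]
  calc _ ≤ (∫⁻ ω in mv ∩ O, W ω ∂μ + C * δ) + C * M * δ := add_le_add hgood hbad
    _ = ∫⁻ ω in mv ∩ O, W ω ∂μ + (C * M + C) * δ := by ring
    _ ≤ _ := add_le_add_left (lintegral_mono_set Set.inter_subset_left) _

/-- The product of the factors `φ` over the moves of the particles of `F` between two times. -/
noncomputable def stepProd (Z : ARW K η₀ lam μ) (φ : V → V → ℝ≥0∞) (F : Finset (Particle η₀))
    (s t : ℝ≥0) (ω : Ω) : ℝ≥0∞ :=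
  ∏ p ∈ F, φ (Z.pos p s ω) (Z.pos p t ω)

lemma measurable_stepProd [Countable V] (Z : ARW K η₀ lam μ) (φ : V → V → ℝ≥0∞)
    (F : Finset (Particle η₀)) {s t : ℝ≥0} (hst : s ≤ t) :
    Measurable[Z.ℱ t] (Z.stepProd φ F s t) := by
  unfold stepProd
  exact Finset.measurable_fun_prod _ fun p _ => Z.measurable_comp_pos p hst φ

lemma stepProd_le (Z : ARW K η₀ lam μ) (φ : V → V → ℝ≥0∞) {M : ℝ≥0∞} (hM : ∀ y z, φ y z ≤ M)
    (F : Finset (Particle η₀)) (s t : ℝ≥0) (ω : Ω) : Z.stepProd φ F s t ω ≤ M ^ F.card :=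
  Finset.prod_le_pow_card _ _ _ fun _ _ => hM _ _

/-- The constant in the error estimate for one step of the grid. -/
noncomputable def stepConst (M : ℝ≥0∞) (k : ℕ) : ℝ≥0∞ :=
  (M ^ k + k) * (k * k : ℕ) + k * (M + 1)

lemma stepConst_ne_top {M : ℝ≥0∞} (hM : M ≠ ⊤) (k : ℕ) : stepConst M k ≠ ⊤ := by
  unfold stepConst
  finiteness

lemma lintegral_stepProd_le [Countable V] [IsProbabilityMeasure μ] (Z : ARW K η₀ lam μ)
    (hK : ∀ y z, 0 ≤ K y z) (hKs : ∀ y, K y y = 0) (φ : V → V → ℝ≥0∞) (M C : ℝ≥0∞)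
    (hφ1 : ∀ y, φ y y = 1)
    (hM : ∀ y z, φ y z ≤ M) (hφ : ∀ y, ∑' z, ENNReal.ofReal (K y z) * φ y z ≤ 1)
    (F : Finset (Particle η₀)) {s t : ℝ≥0} (hst : s ≤ t) (W : Ω → ℝ≥0∞)
    (hW : Measurable[Z.ℱ s] W) (hC : ∀ ω, W ω ≤ C) :
    ∫⁻ ω, W ω * Z.stepProd φ F s t ω ∂μ ≤ ∫⁻ ω, W ω ∂μ +
      C * stepConst M F.card * ENNReal.ofReal (((t - s : ℝ≥0) : ℝ) ^ 2) := by
  classical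
  have hWm : Measurable W := hW.mono (Z.ℱ.le s) le_rfl
  set δ := ENNReal.ofReal (((t - s : ℝ≥0) : ℝ) ^ 2) with hδ
  set mv : Particle η₀ → Set Ω := fun p => Z.moved p s t with hmv
  have hmvm : ∀ p, MeasurableSet (mv p) := fun p => Z.measurableSet_moved p hst
  set bad : Set Ω := ⋃ a ∈ F.offDiag, mv a.1 ∩ mv a.2 with hbad
  have hbadm : MeasurableSet bad :=
    Finset.measurableSet_biUnion _ fun a _ => (hmvm a.1).inter (hmvm a.2)
  set still : Set Ω := (⋃ p ∈ F, mv p)ᶜ with hstill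
  have hstillm : MeasurableSet still := (Finset.measurableSet_biUnion _ fun p _ => hmvm p).compl
  have hμbad : μ bad ≤ (F.card * F.card : ℕ) * δ := by
    calc μ bad ≤ ∑ a ∈ F.offDiag, μ (mv a.1 ∩ mv a.2) := measure_biUnion_finset_le _ _
      _ ≤ ∑ a ∈ F.offDiag, δ := by
          refine Finset.sum_le_sum fun a ha => ?_
          rw [Finset.mem_offDiag] at ha
          refine le_trans (measure_mono_ae ?_) (Z.measure_both_ring_le ha.2.2 hst)
          filter_upwards [Z.ae_regular hKs] with ω hω hmem
          have key : ∀ p, ω ∈ mv p → Z.jumps p s ω < Z.jumps p t ω := by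
            intro p hp
            refine lt_of_le_of_ne (Z.jumps_mono p ω hst) fun h => hp ?_
            exact (IsRegularPath.pos_eq_of_jump_eq hω hst h.symm).symm
          exact ⟨key _ hmem.1, key _ hmem.2⟩
      _ = F.offDiag.card * δ := by rw [Finset.sum_const, nsmul_eq_mul]
      _ ≤ (F.card * F.card : ℕ) * δ := by
          refine mul_le_mul_left ?_ _
          rw [Finset.offDiag_card]
          exact_mod_cast Nat.sub_le _ _
  have hcase : ∀ ω, ω ∉ bad → ω ∈ still ∨ ∃ p ∈ F, ω ∈ mv p ∧ ω ∉ still ∧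
      ∀ q ∈ F, q ≠ p → ω ∉ mv q := by
    intro ω hω
    by_cases hs : ω ∈ still
    · exact Or.inl hs
    · right
      simp only [hstill, Set.mem_compl_iff, Set.mem_iUnion, not_not] at hs
      obtain ⟨p, hp, hpm⟩ := hs
      refine ⟨p, hp, hpm, ?_, fun q hq hqp hqm => hω ?_⟩
      · simp only [hstill, Set.mem_compl_iff, Set.mem_iUnion, not_not]
        exact ⟨p, hp, hpm⟩
      · simp only [hbad, Set.mem_iUnion]
        exact ⟨(q, p), Finset.mem_offDiag.2 ⟨hq, hp, hqp⟩, hqm, hpm⟩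
  have hφ_still : ∀ ω p, ω ∉ mv p → φ (Z.pos p s ω) (Z.pos p t ω) = 1 := by
    intro ω p h
    have h' : Z.pos p s ω = Z.pos p t ω := not_not.1 h
    rw [h', hφ1]
  have hnot_still : ∀ ω p, p ∈ F → ω ∈ still → ω ∉ mv p := by
    intro ω p hp hs hm
    apply hs
    simp only [Set.mem_iUnion]
    exact ⟨p, hp, hm⟩
  have hpt1 : ∀ ω, W ω * Z.stepProd φ F s t ω ≤ bad.indicator (fun _ => C * M ^ F.card) ω +
      still.indicator W ω +
      ∑ p ∈ F, (mv p).indicator (fun ω => W ω * φ (Z.pos p s ω) (Z.pos p t ω)) ω := by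
    intro ω
    by_cases hb : ω ∈ bad
    · rw [Set.indicator_of_mem hb, add_assoc]
      exact (mul_le_mul' (hC ω) (Z.stepProd_le φ hM F s t ω)).trans le_self_add
    · rcases hcase ω hb with hs | ⟨p, hp, hpm, -, hq⟩
      · have h1 : Z.stepProd φ F s t ω = 1 :=
          Finset.prod_eq_one fun p hp => hφ_still ω p (hnot_still ω p hp hs)
        rw [h1, mul_one, Set.indicator_of_mem hs]
        exact le_add_self.trans le_self_add
      · have h1 : Z.stepProd φ F s t ω = φ (Z.pos p s ω) (Z.pos p t ω) :=
          Finset.prod_eq_single_of_mem p hp fun q hqF hqp => hφ_still ω q (hq q hqF hqp)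
        rw [h1]
        refine le_trans ?_ le_add_self
        refine le_trans (le_of_eq ?_) (Finset.single_le_sum (fun _ _ => zero_le) hp)
        rw [Set.indicator_of_mem hpm]
  have hpt2 : ∀ ω, still.indicator W ω + ∑ p ∈ F, (mv p).indicator W ω ≤
      W ω + bad.indicator (fun _ => C * F.card) ω := by
    intro ω
    have hsum : ∑ p ∈ F, (mv p).indicator W ω ≤ C * F.card := by
      refine (Finset.sum_le_card_nsmul F _ C fun p _ => ?_).trans (by
        rw [nsmul_eq_mul, mul_comm])
      exact (Set.indicator_le_self _ _ _).trans (hC ω)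
    by_cases hb : ω ∈ bad
    · rw [Set.indicator_of_mem hb]
      exact add_le_add (Set.indicator_le_self _ _ _) hsum
    · rw [Set.indicator_of_notMem hb, add_zero]
      rcases hcase ω hb with hs | ⟨p, hp, hpm, hns, hq⟩
      · rw [Finset.sum_eq_zero fun p hp =>
          Set.indicator_of_notMem (hnot_still ω p hp hs) W, add_zero]
        exact Set.indicator_le_self _ _ _
      · rw [Set.indicator_of_notMem hns, zero_add, Finset.sum_eq_single_of_mem p hp fun q hqF hqp =>
          Set.indicator_of_notMem (hq q hqF hqp) W]
        exact Set.indicator_le_self _ _ _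
  have hφm : ∀ p, Measurable fun ω => W ω * φ (Z.pos p s ω) (Z.pos p t ω) := fun p =>
    hWm.mul ((Z.measurable_comp_pos p hst φ).mono (Z.ℱ.le t) le_rfl)
  calc ∫⁻ ω, W ω * Z.stepProd φ F s t ω ∂μ
      ≤ ∫⁻ ω, (bad.indicator (fun _ => C * M ^ F.card) ω + still.indicator W ω +
      ∑ p ∈ F, (mv p).indicator (fun ω => W ω * φ (Z.pos p s ω) (Z.pos p t ω)) ω) ∂μ :=
        lintegral_mono hpt1
    _ = C * M ^ F.card * μ bad + ∫⁻ ω, still.indicator W ω ∂μ +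
      ∑ p ∈ F, ∫⁻ ω in mv p, W ω * φ (Z.pos p s ω) (Z.pos p t ω) ∂μ := by
        rw [lintegral_add_left (f := fun ω => bad.indicator (fun _ => C * M ^ F.card) ω +
            still.indicator W ω) ((measurable_const.indicator hbadm).add (hWm.indicator hstillm)),
          lintegral_add_left (measurable_const.indicator hbadm), lintegral_indicator hbadm,
          setLIntegral_const, lintegral_finsetSum _ fun p _ => (hφm p).indicator (hmvm p)]
        simp only [lintegral_indicator (hmvm _)]
    _ ≤ C * M ^ F.card * μ bad + ∫⁻ ω, still.indicator W ω ∂μ +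
      ∑ p ∈ F, (∫⁻ ω in mv p, W ω ∂μ + (C * M + C) * δ) := by
        refine add_le_add_right (Finset.sum_le_sum fun p _ => ?_) _
        exact Z.lintegral_moved_le hK hKs φ M C hM hφ p hst W hW hC
    _ = C * M ^ F.card * μ bad + F.card * ((C * M + C) * δ) +
        ∫⁻ ω, (still.indicator W ω + ∑ p ∈ F, (mv p).indicator W ω) ∂μ := by
        rw [lintegral_add_left (hWm.indicator hstillm),
          lintegral_finsetSum _ fun p _ => hWm.indicator (hmvm p), Finset.sum_add_distrib,
          Finset.sum_const, nsmul_eq_mul]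
        simp only [lintegral_indicator (hmvm _)]
        ring
    _ ≤ C * M ^ F.card * μ bad + F.card * ((C * M + C) * δ) +
        (∫⁻ ω, W ω ∂μ + C * F.card * μ bad) := by
        refine add_le_add_right ?_ _
        refine (lintegral_mono hpt2).trans ?_
        rw [lintegral_add_left hWm, lintegral_indicator hbadm, setLIntegral_const]
    _ = ∫⁻ ω, W ω ∂μ + (C * (M ^ F.card + F.card) * μ bad + C * (F.card * (M + 1)) * δ) := by
        ring
    _ ≤ ∫⁻ ω, W ω ∂μ + (C * (M ^ F.card + F.card) * ((F.card * F.card : ℕ) * δ) +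
        C * (F.card * (M + 1)) * δ) := by gcongr
    _ = _ := by rw [stepConst]; ring

/-- The product of the factors `φ` over the first `n` steps of a grid with mesh `d`. -/
noncomputable def gridProd (Z : ARW K η₀ lam μ) (φ : V → V → ℝ≥0∞) (F : Finset (Particle η₀))
    (d : ℝ≥0) (n : ℕ) (ω : Ω) : ℝ≥0∞ :=
  ∏ i ∈ Finset.range n, Z.stepProd φ F (i * d) ((i + 1 : ℕ) * d) ω

open Classical in
/-- The process `gridProd`, stopped when it exceeds the level `L`. -/
noncomputable def stoppedProd (Z : ARW K η₀ lam μ) (φ : V → V → ℝ≥0∞) (F : Finset (Particle η₀))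
    (d : ℝ≥0) (L : ℝ≥0∞) : ℕ → Ω → ℝ≥0∞
  | 0 => fun _ => 1
  | n + 1 => fun ω => if Z.stoppedProd φ F d L n ω ≤ L then
      Z.stoppedProd φ F d L n ω * Z.stepProd φ F (n * d) ((n + 1 : ℕ) * d) ω
      else Z.stoppedProd φ F d L n ω

lemma stoppedProd_succ_of_le (Z : ARW K η₀ lam μ) {φ : V → V → ℝ≥0∞} {F : Finset (Particle η₀)}
    {d : ℝ≥0} {L : ℝ≥0∞} {n : ℕ} {ω : Ω} (h : Z.stoppedProd φ F d L n ω ≤ L) :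
    Z.stoppedProd φ F d L (n + 1) ω =
      Z.stoppedProd φ F d L n ω * Z.stepProd φ F (n * d) ((n + 1 : ℕ) * d) ω :=
  if_pos h

lemma stoppedProd_succ_of_not_le (Z : ARW K η₀ lam μ) {φ : V → V → ℝ≥0∞}
    {F : Finset (Particle η₀)} {d : ℝ≥0} {L : ℝ≥0∞} {n : ℕ} {ω : Ω}
    (h : ¬ Z.stoppedProd φ F d L n ω ≤ L) :
    Z.stoppedProd φ F d L (n + 1) ω = Z.stoppedProd φ F d L n ω :=
  if_neg h

lemma grid_le (d : ℝ≥0) (n : ℕ) : (n : ℝ≥0) * d ≤ ((n + 1 : ℕ) : ℝ≥0) * d := by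
  gcongr
  exact Nat.le_succ n

lemma measurable_stoppedProd [Countable V] (Z : ARW K η₀ lam μ) (φ : V → V → ℝ≥0∞)
    (F : Finset (Particle η₀)) (d : ℝ≥0) (L : ℝ≥0∞) (n : ℕ) :
    Measurable[Z.ℱ (n * d)] (Z.stoppedProd φ F d L n) := by
  classical
  induction n with
  | zero => exact measurable_const
  | succ n ih =>
    have h1 := ih.mono (Z.ℱ.mono (grid_le d n)) le_rfl
    have h2 : MeasurableSet[Z.ℱ ((n + 1 : ℕ) * d)] {ω | Z.stoppedProd φ F d L n ω ≤ L} :=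
      h1 measurableSet_Iic
    exact Measurable.ite h2 (h1.mul (Z.measurable_stepProd φ F (grid_le d n))) h1

lemma stoppedProd_le (Z : ARW K η₀ lam μ) (φ : V → V → ℝ≥0∞) {M : ℝ≥0∞} (hM1 : 1 ≤ M)
    (hM : ∀ y z, φ y z ≤ M) (F : Finset (Particle η₀)) (d : ℝ≥0) (L : ℝ≥0∞) (n : ℕ) (ω : Ω) :
    Z.stoppedProd φ F d L n ω ≤ (1 + L) * M ^ F.card := by
  classical
  induction n with
  | zero =>
    calc (1 : ℝ≥0∞) = 1 * 1 := by ring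
      _ ≤ (1 + L) * M ^ F.card := mul_le_mul' le_self_add (one_le_pow₀ hM1)
  | succ n ih =>
    simp only [stoppedProd]
    split_ifs with h
    · exact mul_le_mul' (h.trans le_add_self) (Z.stepProd_le φ hM F _ _ ω)
    · exact ih

lemma stoppedProd_eq_or_lt (Z : ARW K η₀ lam μ) (φ : V → V → ℝ≥0∞) (F : Finset (Particle η₀))
    (d : ℝ≥0) (L : ℝ≥0∞) (n : ℕ) (ω : Ω) :
    Z.stoppedProd φ F d L n ω = Z.gridProd φ F d n ω ∨ L < Z.stoppedProd φ F d L n ω := by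
  classical
  induction n with
  | zero => left; simp [stoppedProd, gridProd]
  | succ n ih =>
    by_cases h : Z.stoppedProd φ F d L n ω ≤ L
    · left
      rw [Z.stoppedProd_succ_of_le h, gridProd, Finset.prod_range_succ,
        ih.resolve_right h.not_gt]
      rfl
    · right
      rw [Z.stoppedProd_succ_of_not_le h]
      exact not_le.1 h

lemma lintegral_stoppedProd_le [Countable V] [IsProbabilityMeasure μ] (Z : ARW K η₀ lam μ)
    (hK : ∀ y z, 0 ≤ K y z) (hKs : ∀ y, K y y = 0) (φ : V → V → ℝ≥0∞) (M : ℝ≥0∞) (hM1 : 1 ≤ M)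
    (hφ1 : ∀ y, φ y y = 1)
    (hM : ∀ y z, φ y z ≤ M) (hφ : ∀ y, ∑' z, ENNReal.ofReal (K y z) * φ y z ≤ 1)
    (F : Finset (Particle η₀)) (d : ℝ≥0) (L : ℝ≥0∞) (n : ℕ) :
    ∫⁻ ω, Z.stoppedProd φ F d L n ω ∂μ ≤
      1 + n * ((1 + L) * M ^ F.card * stepConst M F.card * ENNReal.ofReal ((d : ℝ) ^ 2)) := by
  classical
  induction n with
  | zero => simp [stoppedProd]
  | succ n ih =>
    have hVm := Z.measurable_stoppedProd φ F d L n
    have hVm' : Measurable (Z.stoppedProd φ F d L n) := hVm.mono (Z.ℱ.le _) le_rfl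
    set S := {ω | Z.stoppedProd φ F d L n ω ≤ L} with hS
    have hSm : MeasurableSet[Z.ℱ (n * d)] S := hVm measurableSet_Iic
    have hSm' : MeasurableSet S := Z.ℱ.le _ _ hSm
    have hstep := Z.lintegral_stepProd_le hK hKs φ M ((1 + L) * M ^ F.card) hφ1 hM hφ F
      (grid_le d n) (S.indicator (Z.stoppedProd φ F d L n)) (hVm.indicator hSm) fun ω =>
        (Set.indicator_le_self _ _ _).trans (Z.stoppedProd_le φ hM1 hM F d L n ω)
    have hdiff : ((n + 1 : ℕ) : ℝ≥0) * d - n * d = d := by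
      rw [Nat.cast_succ, add_mul, one_mul, add_tsub_cancel_left]
    rw [hdiff] at hstep
    have heq : ∀ ω, Z.stoppedProd φ F d L (n + 1) ω =
        S.indicator (Z.stoppedProd φ F d L n) ω * Z.stepProd φ F (n * d) ((n + 1 : ℕ) * d) ω +
        Sᶜ.indicator (Z.stoppedProd φ F d L n) ω := by
      intro ω
      by_cases h : ω ∈ S
      · rw [Z.stoppedProd_succ_of_le h, Set.indicator_of_mem h,
          Set.indicator_of_notMem (Set.notMem_compl_iff.2 h), add_zero]
      · rw [Z.stoppedProd_succ_of_not_le h, Set.indicator_of_notMem h, Set.indicator_of_mem h, zero_mul,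
          zero_add]
    have hsplit : ∫⁻ ω, S.indicator (Z.stoppedProd φ F d L n) ω ∂μ +
        ∫⁻ ω, Sᶜ.indicator (Z.stoppedProd φ F d L n) ω ∂μ = ∫⁻ ω, Z.stoppedProd φ F d L n ω ∂μ := by
      rw [lintegral_indicator hSm', lintegral_indicator hSm'.compl, lintegral_add_compl _ hSm']
    simp only [heq]
    rw [lintegral_add_right _ (hVm'.indicator hSm'.compl)]
    refine (add_le_add_left hstep _).trans ?_
    rw [add_right_comm, hsplit]
    refine (add_le_add_left ih _).trans (le_of_eq ?_)
    push_cast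
    ring

/-- Maximal inequality on fine grids: if `∑ z, K y z * φ y z ≤ 1` for all `y`, then the product
of `φ` over the moves up to time `t` exceeds `L` with probability at most `2 / L`. -/
theorem exists_grid [Countable V] [IsProbabilityMeasure μ] (Z : ARW K η₀ lam μ)
    (hK : ∀ y z, 0 ≤ K y z) (hKs : ∀ y, K y y = 0) (φ : V → V → ℝ≥0∞) (M : ℝ≥0∞) (hM1 : 1 ≤ M)
    (hMtop : M ≠ ⊤) (hφ1 : ∀ y, φ y y = 1)
    (hM : ∀ y z, φ y z ≤ M) (hφ : ∀ y, ∑' z, ENNReal.ofReal (K y z) * φ y z ≤ 1)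
    (F : Finset (Particle η₀)) (t : ℝ≥0) (L : ℝ≥0∞) (hL : L ≠ ⊤) (n₀ : ℕ) :
    ∃ n, n₀ ≤ n ∧ 0 < n ∧ L * μ {ω | L ≤ Z.gridProd φ F (t / n) n ω} ≤ 2 := by
  set c : ℝ≥0∞ := (1 + L) * M ^ F.card * stepConst M F.card with hc
  have hctop : c ≠ ⊤ := by
    have := stepConst_ne_top hMtop F.card
    rw [hc]
    finiteness
  obtain ⟨n₁, hn₁⟩ := exists_nat_ge (c.toReal * (t : ℝ) ^ 2)
  set n := max n₀ (max n₁ 1) with hn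
  have hn0 : 0 < n := lt_of_lt_of_le one_pos ((le_max_right _ _).trans (le_max_right _ _))
  have hn1 : n₁ ≤ n := (le_max_left _ _).trans (le_max_right _ _)
  refine ⟨n, le_max_left _ _, hn0, ?_⟩
  have h1 := Z.lintegral_stoppedProd_le hK hKs φ M hM1 hφ1 hM hφ F (t / n) L n
  have h2 : (n : ℝ≥0∞) * (c * ENNReal.ofReal (((t / n : ℝ≥0) : ℝ) ^ 2)) ≤ 1 := by
    have hnR : (0 : ℝ) < n := by exact_mod_cast hn0
    rw [← ENNReal.ofReal_toReal hctop, ← ENNReal.ofReal_mul ENNReal.toReal_nonneg,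
      ← ENNReal.ofReal_natCast, ← ENNReal.ofReal_mul hnR.le, ENNReal.ofReal_le_one]
    have h3 : (n : ℝ) * (c.toReal * ((t / n : ℝ≥0) : ℝ) ^ 2) = c.toReal * (t : ℝ) ^ 2 / n := by
      push_cast
      field_simp
    rw [h3, div_le_one hnR]
    exact hn₁.trans (by exact_mod_cast hn1)
  calc L * μ {ω | L ≤ Z.gridProd φ F (t / n) n ω}
      ≤ L * μ {ω | L ≤ Z.stoppedProd φ F (t / n) L n ω} := by
        refine mul_le_mul_right (measure_mono fun ω hω => ?_) _
        rcases Z.stoppedProd_eq_or_lt φ F (t / n) L n ω with h | h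
        · exact (show L ≤ Z.gridProd φ F (t / n) n ω from hω).trans h.ge
        · exact h.le
    _ ≤ ∫⁻ ω, Z.stoppedProd φ F (t / n) L n ω ∂μ :=
        mul_meas_ge_le_lintegral ((Z.measurable_stoppedProd φ F (t / n) L n).mono
          (Z.ℱ.le _) le_rfl) L
    _ ≤ 1 + 1 := h1.trans (add_le_add_right h2 _)
    _ = 2 := one_add_one_eq_two

end ARW

/-! ### Propagation of finiteness of hops -/

lemma mul_measure_le_of_eventually {Ω : Type w} {m : MeasurableSpace Ω} {μ : Measure Ω}
    {G : Set Ω} {S : ℕ → Set Ω} {c b : ℝ≥0∞} (h : ∀ᵐ ω ∂μ, ω ∈ G → ∀ᶠ n in atTop, ω ∈ S n)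
    (hS : ∀ n, c * μ (S n) ≤ b) : c * μ G ≤ b := by
  have h1 : μ G ≤ μ (⋃ N, ⋂ n ≥ N, S n) := by
    refine measure_mono_ae ?_
    filter_upwards [h] with ω hω hG
    obtain ⟨N, hN⟩ := eventually_atTop.1 (hω hG)
    exact Set.mem_iUnion.2 ⟨N, Set.mem_iInter₂.2 hN⟩
  have hmono : Monotone fun N => ⋂ n ≥ N, S n := fun N N' hNN ω hω =>
    Set.mem_iInter₂.2 fun n hn => Set.mem_iInter₂.1 hω n (le_trans hNN hn)
  rw [hmono.measure_iUnion] at h1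
  calc c * μ G ≤ c * ⨆ N, μ (⋂ n ≥ N, S n) := mul_le_mul_right h1 _
    _ = ⨆ N, c * μ (⋂ n ≥ N, S n) := ENNReal.mul_iSup _ _
    _ ≤ b := iSup_le fun N => (mul_le_mul_right (measure_mono fun ω hω =>
        Set.mem_iInter₂.1 hω N le_rfl) _).trans (hS N)

lemma eq_zero_of_forall_mul_le {a : ℝ≥0∞} (ha : a ≠ ⊤)
    (h : ∀ C : ℝ, ∃ L, C ≤ L ∧ ENNReal.ofReal L * a ≤ 2) : a = 0 := by
  by_contra hne
  have hpos : 0 < a.toReal := ENNReal.toReal_pos hne ha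
  obtain ⟨L, hL, hLa⟩ := h (3 / a.toReal)
  have hL0 : 0 ≤ L := le_trans (by positivity) hL
  rw [← ENNReal.ofReal_toReal ha, ← ENNReal.ofReal_mul hL0,
    ← ENNReal.ofReal_ofNat, ENNReal.ofReal_le_ofReal_iff (by norm_num)] at hLa
  rw [div_le_iff₀ hpos] at hL
  linarith

lemma exists_finset_exhaustion (α : Type u) [Countable α] :
    ∃ F : ℕ → Finset α, ∀ a, ∀ᶠ n in atTop, a ∈ F n := by
  obtain ⟨e, he⟩ := exists_injective_nat α
  refine ⟨fun n => ((Set.finite_Iio n).preimage he.injOn).toFinset, fun a => ?_⟩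
  filter_upwards [eventually_gt_atTop (e a)] with n hn
  simpa using hn

/-- Moves in distinct windows of a grid come from distinct hops. -/
lemma card_le_ncard_of_window {α : Type u} {S : Set (α × ℝ≥0)} (hS : S.Finite) {d : ℝ≥0}
    {T : Finset (α × ℕ)} (h : ∀ a ∈ T, ∃ τ, (a.2 : ℝ≥0) * d < τ ∧ τ ≤ ((a.2 + 1 : ℕ) : ℝ≥0) * d ∧
      (a.1, τ) ∈ S) : T.card ≤ S.ncard := by
  choose! f hf using h
  rw [← Set.ncard_coe_finset]
  refine Set.ncard_le_ncard_of_injOn (fun a => (a.1, f a)) (fun a ha => (hf a ha).2.2) ?_ hS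
  have key : ∀ a ∈ T, ∀ b ∈ T, f a = f b → a.2 ≤ b.2 := by
    intro a ha b hb hab
    by_contra! hlt
    have h1 := (hf a ha).1
    have h2 := (hf b hb).2.1
    have h3 : ((b.2 + 1 : ℕ) : ℝ≥0) * d ≤ a.2 * d := by
      gcongr
      exact hlt
    rw [hab] at h1
    exact absurd (h2.trans h3) h1.not_ge
  intro a ha b hb hab
  simp only [Prod.mk.injEq] at hab
  exact Prod.ext hab.1 (le_antisymm (key a ha b hb hab.2) (key b hb a ha hab.2.symm))

lemma exists_window {d τ : ℝ≥0} {n : ℕ} (h0 : 0 < τ) (hn : τ ≤ n * d) :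
    ∃ i < n, (i : ℝ≥0) * d < τ ∧ τ ≤ ((i + 1 : ℕ) : ℝ≥0) * d := by
  classical
  have hex : ∃ k : ℕ, τ ≤ k * d := ⟨n, hn⟩
  have hspec := Nat.find_spec hex
  have hpos : Nat.find hex ≠ 0 := by
    intro h
    rw [h, Nat.cast_zero, zero_mul] at hspec
    exact absurd h0 hspec.not_gt
  obtain ⟨i, hi⟩ := Nat.exists_eq_succ_of_ne_zero hpos
  refine ⟨i, ?_, ?_, ?_⟩
  · have := Nat.find_min' hex hn
    omega
  · exact not_le.1 (Nat.find_min hex (by omega))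
  · rw [hi] at hspec
    exact hspec

namespace IsRegularPath

variable {V : Type u} {η₀ : V → ℕ} {lam : ℝ≥0∞} {jump sleep : Particle η₀ → ℝ≥0 → ℕ}
  {st : Particle η₀ → ℝ≥0 → V × Bool}

/-- A hop from `y` is seen on every sufficiently fine grid. -/
lemma eventually_seen (H : IsRegularPath η₀ lam jump sleep st) {y : V} {p : Particle η₀}
    {τ : ℝ≥0} (h : (p, τ) ∈ hopsFrom jump st y) : ∀ᶠ d in 𝓝 (0 : ℝ≥0), ∀ i : ℕ,
      (i : ℝ≥0) * d < τ → τ ≤ ((i + 1 : ℕ) : ℝ≥0) * d → (st p (i * d)).1 = y ∧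
        (st p ((i + 1 : ℕ) * d)).1 ≠ y ∧ (st p τ).1 ≠ y ∧
        ∀ σ, i * d < σ → σ < τ → (st p σ).1 = y := by
  obtain ⟨z, hz⟩ := h
  have hzy : (st p τ).1 ≠ y := by
    intro heq
    have h1 : z = y := hz.2.2.symm.trans heq
    subst h1
    exact H.no_self_hop p τ z hz
  obtain ⟨l, hl, hlt⟩ := hz.2.1.exists_Ioo hz.1.1
  obtain ⟨r, hr, hsub⟩ := mem_nhdsGT_iff_exists_Ioo_subset.1 (H.right_cont p τ)
  filter_upwards [gt_mem_nhds (tsub_pos_of_lt hl), gt_mem_nhds (tsub_pos_of_lt hr)]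
    with d hd1 hd2 i h1 h2
  have hsucc : ((i + 1 : ℕ) : ℝ≥0) * d = i * d + d := by push_cast; ring
  have h3 : l < i * d := by
    have h4 := lt_tsub_iff_right.1 hd1
    rw [hsucc] at h2
    have h5 : d + l < d + i * d := by rw [add_comm d (i * d)]; exact h4.trans_le h2
    exact lt_of_add_lt_add_left h5
  refine ⟨by rw [hlt _ h3 h1], ?_, hzy, fun σ g1 g2 => by rw [hlt σ (h3.trans g1) g2]⟩
  rcases h2.eq_or_lt with h4 | h4
  · rw [← h4]; exact hzy
  · have h5 : ((i + 1 : ℕ) : ℝ≥0) * d < r := by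
      have h6 := lt_tsub_iff_left.1 hd2
      rw [hsucc]
      exact (add_lt_add_left h1 d).trans h6
    rw [show st p (((i + 1 : ℕ) : ℝ≥0) * d) = st p τ from hsub ⟨h4, h5⟩]
    exact hzy

open Classical in
/-- The moves away from `y` seen on a fine grid are at least as many as any finite set of hops
from `y` by the particles and within the time under consideration. -/
lemma eventually_card_le (H : IsRegularPath η₀ lam jump sleep st) {y : V}
    {U : Finset (Particle η₀ × ℝ≥0)} (hU : ∀ q ∈ U, q ∈ hopsFrom jump st y) :
    ∀ᶠ d in 𝓝 (0 : ℝ≥0), ∀ (F : Finset (Particle η₀)) (n : ℕ),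
      (∀ q ∈ U, q.1 ∈ F ∧ q.2 ≤ n * d) → U.card ≤ ((F ×ˢ Finset.range n).filter fun a =>
        (st a.1 (a.2 * d)).1 = y ∧ (st a.1 ((a.2 + 1 : ℕ) * d)).1 ≠ y).card := by
  have h1 : ∀ᶠ d in 𝓝 (0 : ℝ≥0), ∀ q ∈ U, ∀ i : ℕ,
      (i : ℝ≥0) * d < q.2 → q.2 ≤ ((i + 1 : ℕ) : ℝ≥0) * d → (st q.1 (i * d)).1 = y ∧
        (st q.1 ((i + 1 : ℕ) * d)).1 ≠ y ∧ (st q.1 q.2).1 ≠ y ∧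
        ∀ σ, i * d < σ → σ < q.2 → (st q.1 σ).1 = y :=
    (Filter.eventually_all_finset U).2 fun q hq => H.eventually_seen (hU q hq)
  filter_upwards [h1] with d hd F n hFn
  have hex : ∀ q ∈ U, ∃ i < n, (i : ℝ≥0) * d < q.2 ∧ q.2 ≤ ((i + 1 : ℕ) : ℝ≥0) * d :=
    fun q hq => exists_window (hU q hq).choose_spec.1.1 (hFn q hq).2
  choose! f hf using hex
  refine Finset.card_le_card_of_injOn (fun q => (q.1, f q)) ?_ ?_
  · intro q hq
    have h2 := hf q hq
    have h3 := hd q hq (f q) h2.2.1 h2.2.2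
    simp only [Finset.coe_filter, Finset.mem_product, Finset.mem_range, Set.mem_ofPred_eq]
    exact ⟨⟨(hFn q hq).1, h2.1⟩, h3.1, h3.2.1⟩
  · have key : ∀ q ∈ U, ∀ q' ∈ U, q.1 = q'.1 → f q = f q' → q'.2 ≤ q.2 := by
      intro q hq q' hq' h4 h5
      by_contra! hlt
      have h2 := hf q hq
      have h2' := hf q' hq'
      have h3 := hd q hq (f q) h2.2.1 h2.2.2
      have h3' := hd q' hq' (f q') h2'.2.1 h2'.2.2
      have h6 := h3'.2.2.2 q.2 (by rw [← h5]; exact h2.2.1) hlt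
      rw [← h4] at h6
      exact h3.2.2.1 h6
    intro q hq q' hq' heq
    simp only [Prod.mk.injEq] at heq
    exact Prod.ext heq.1 (le_antisymm (key q' hq' q hq heq.1.symm heq.2.symm)
      (key q hq q' hq' heq.1 heq.2))

end IsRegularPath

namespace ARW

variable {V : Type u} {K : V → V → ℝ} {η₀ : V → ℕ} {lam : ℝ≥0∞} {Ω : Type w}
  {m : MeasurableSpace Ω} {μ : Measure Ω} {G : SimpleGraph V} {nb : V → Finset V} {wt : V → ℝ}
  {γ : ℝ}

/-- The product of the real factors `ψ` over the moves of the particles of `F` in the first `n`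
steps of a grid of mesh `d`. -/
noncomputable def moveProd (Z : ARW K η₀ lam μ) (ψ : V → V → ℝ) (F : Finset (Particle η₀))
    (d : ℝ≥0) (n : ℕ) (ω : Ω) : ℝ :=
  ∏ a ∈ F ×ˢ Finset.range n, ψ (Z.pos a.1 (a.2 * d) ω) (Z.pos a.1 ((a.2 + 1 : ℕ) * d) ω)

theorem exists_moveProd_le [Countable V] [IsProbabilityMeasure μ] (Z : ARW K η₀ lam μ)
    (hK : ReversibleWalk G K nb wt γ) (ψ : V → V → ℝ) (M : ℝ) (hψ0 : ∀ y z, 0 ≤ ψ y z)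
    (hψ1 : ∀ y, ψ y y = 1) (hM : ∀ y z, ψ y z ≤ M) (hψ : ∀ y, stepAverage K nb (ψ y) y ≤ 1)
    (F : Finset (Particle η₀)) (t : ℝ≥0) (L : ℝ) (n₀ : ℕ) :
    ∃ n, n₀ ≤ n ∧ 0 < n ∧
      ENNReal.ofReal L * μ {ω | L ≤ Z.moveProd ψ F (t / n) n ω} ≤ 2 := by
  have hsum : ∀ y, ∑' z, ENNReal.ofReal (K y z) * ENNReal.ofReal (ψ y z) ≤ 1 := by
    intro y
    rw [tsum_eq_sum (s := nb y) fun z hz => by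
      rw [hK.kernel_zero_of_notMem hz, ENNReal.ofReal_zero, zero_mul]]
    simp only [← ENNReal.ofReal_mul (hK.kernel_nonneg _ _)]
    rw [← ENNReal.ofReal_sum_of_nonneg fun z _ => mul_nonneg (hK.kernel_nonneg _ _) (hψ0 _ _),
      ENNReal.ofReal_le_one]
    exact hψ y
  obtain ⟨n, h1, h2, h3⟩ := Z.exists_grid hK.kernel_nonneg hK.kernel_self
    (fun y z => ENNReal.ofReal (ψ y z)) (ENNReal.ofReal (max M 1))
    (ENNReal.one_le_ofReal.2 (le_max_right _ _)) ENNReal.ofReal_ne_top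
    (fun y => by simp only [hψ1, ENNReal.ofReal_one])
    (fun y z => ENNReal.ofReal_le_ofReal ((hM y z).trans (le_max_left _ _))) hsum F t
    (ENNReal.ofReal L) ENNReal.ofReal_ne_top n₀
  refine ⟨n, h1, h2, le_trans (mul_le_mul_right (measure_mono fun ω hω => ?_) _) h3⟩
  have heq : Z.gridProd (fun y z => ENNReal.ofReal (ψ y z)) F (t / n) n ω
      = ENNReal.ofReal (Z.moveProd ψ F (t / n) n ω) := by
    rw [moveProd, ENNReal.ofReal_prod_of_nonneg fun a _ => hψ0 _ _, Finset.prod_product_right]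
    rfl
  exact (ENNReal.ofReal_le_ofReal hω).trans heq.ge

/-- The hops from `y` along the trajectory of `ω`. -/
def hopsFromAt (Z : ARW K η₀ lam μ) (y : V) (ω : Ω) : Set (Particle η₀ × ℝ≥0) :=
  hopsFrom (fun p t => Z.clock (Sum.inl p) t ω) (fun p t => Z.state p t ω) y

/-- The hops to `y` along the trajectory of `ω`. -/
def hopsToAt (Z : ARW K η₀ lam μ) (y : V) (ω : Ω) : Set (Particle η₀ × ℝ≥0) :=
  hopsTo (fun p t => Z.clock (Sum.inl p) t ω) (fun p t => Z.state p t ω) y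

open Classical in
/-- The factors which reward moves from `y` and penalize moves from `y` to `x`. -/
noncomputable def edgeFactor (y x : V) (θ : ℝ) (a b : V) : ℝ :=
  (if a = y ∧ b ≠ y then 1 + θ else 1) * (if a = y ∧ b ≠ y ∧ b = x then 1 / 2 else 1)

lemma stepAverage_edgeFactor_le (hK : ReversibleWalk G K nb wt γ) {y x : V} (hyx : G.Adj y x)
    (a : V) : stepAverage K nb (edgeFactor y x (K y x / 2) a) a ≤ 1 := by
  classical
  by_cases ha : a = y
  · subst ha
    have hκ := hK.kernel_nonneg a x
    have hx : x ∈ nb a := (hK.mem_nb a x).2 hyx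
    have h1 : stepAverage K nb (edgeFactor a x (K a x / 2) a) a
        = ∑ z ∈ nb a, ((1 + K a x / 2) * K a z -
          (1 + K a x / 2) * (if z = x then K a x / 2 else 0)) := by
      refine Finset.sum_congr rfl fun z hz => ?_
      have hza : z ≠ a := ((hK.mem_nb a z).1 hz).ne'
      by_cases hzx : z = x
      · subst hzx; simp [edgeFactor, hza]; ring
      · simp [edgeFactor, hza, hzx]; ring
    rw [h1, Finset.sum_sub_distrib, ← Finset.mul_sum, ← Finset.mul_sum, hK.sum_one,
      Finset.sum_ite_eq' , if_pos hx]
    nlinarith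
  · refine le_of_eq ?_
    have : edgeFactor y x (K y x / 2) a = fun _ => 1 := by
      ext b; simp [edgeFactor, ha]
    rw [this, hK.stepAverage_const]

/-- Almost surely, if finitely many hops to `x` occur, then finitely many hops from each
neighbor of `x` occur. -/
theorem ae_finite_hopsFrom_neighbor [Countable V] [IsProbabilityMeasure μ] (Z : ARW K η₀ lam μ)
    (hK : ReversibleWalk G K nb wt γ) {y x : V} (hyx : G.Adj y x) :
    ∀ᵐ ω ∂μ, (Z.hopsToAt x ω).Finite → (Z.hopsFromAt y ω).Finite := by
  classical
  have hκ : 0 < K y x := hK.pos.trans_le (hK.lower y x hyx)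
  set θ := K y x / 2 with hθ
  have hθ0 : 0 < θ := by positivity
  suffices h : ∀ r : ℕ, μ {ω | (Z.hopsToAt x ω).Finite ∧ (Z.hopsToAt x ω).ncard ≤ r ∧
      ¬ (Z.hopsFromAt y ω).Finite} = 0 by
    have h' : ∀ᵐ ω ∂μ, ∀ r : ℕ, ¬ ((Z.hopsToAt x ω).Finite ∧ (Z.hopsToAt x ω).ncard ≤ r ∧
        ¬ (Z.hopsFromAt y ω).Finite) := by
      rw [ae_all_iff]; intro r
      rw [ae_iff]
      simpa only [not_not] using h r
    filter_upwards [h'] with ω hω hfin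
    by_contra hinf
    exact hω _ ⟨hfin, le_rfl, hinf⟩
  intro r
  refine eq_zero_of_forall_mul_le (measure_ne_top μ _) fun C => ?_
  obtain ⟨k, hk⟩ := pow_unbounded_of_one_lt (C * 2 ^ r) (show 1 < 1 + θ by linarith)
  refine ⟨(1 + θ) ^ k * (1 / 2) ^ r, ?_, ?_⟩
  · rw [one_div, inv_pow, ← div_eq_mul_inv, le_div_iff₀ (by positivity)]
    exact hk.le
  set L : ℝ := (1 + θ) ^ k * (1 / 2) ^ r with hL
  obtain ⟨F, hF⟩ := exists_finset_exhaustion (Particle η₀)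
  have hgrid := fun n : ℕ => Z.exists_moveProd_le hK (edgeFactor y x θ) (1 + θ)
    (fun a b => by unfold edgeFactor; split_ifs <;> positivity)
    (fun a => by unfold edgeFactor; rw [if_neg (by tauto), if_neg (by tauto), one_mul])
    (fun a b => by unfold edgeFactor; split_ifs <;> linarith)
    (stepAverage_edgeFactor_le hK hyx) (F n) n L (n * n)
  choose N hN1 hN2 hN3 using hgrid
  refine mul_measure_le_of_eventually (S := fun n => {ω | L ≤
    Z.moveProd (edgeFactor y x θ) (F n) (n / N n) (N n) ω}) ?_ hN3
  have hmesh : Tendsto (fun n : ℕ => (n : ℝ≥0) / N n) atTop (𝓝 0) := by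
    have h0 : Tendsto (fun n : ℕ => ((n : ℝ≥0))⁻¹) atTop (𝓝 0) :=
      tendsto_inv_atTop_nhds_zero_nat
    refine tendsto_of_tendsto_of_tendsto_of_le_of_le tendsto_const_nhds h0
      (fun _ => zero_le) fun n => ?_
    rcases Nat.eq_zero_or_pos n with hn | hn
    · simp [hn]
    · have hnp : (0 : ℝ≥0) < n := by exact_mod_cast hn
      have hNp : (0 : ℝ≥0) < N n := by exact_mod_cast hN2 n
      change (n : ℝ≥0) / N n ≤ (n : ℝ≥0)⁻¹
      rw [div_le_iff₀ hNp, ← div_eq_inv_mul, le_div_iff₀ hnp]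
      exact_mod_cast hN1 n
  filter_upwards [Z.ae_regular hK.kernel_self] with ω hω
  rintro ⟨hfin, hr, hinf⟩
  obtain ⟨U, hU, hUk⟩ := Set.Infinite.exists_subset_card_eq hinf k
  have hev := hmesh.eventually (IsRegularPath.eventually_card_le hω (U := U) fun q hq => hU hq)
  have hFU : ∀ᶠ n in atTop, ∀ q ∈ U, q.1 ∈ F n :=
    (Filter.eventually_all_finset U).2 fun q _ => hF q.1
  have htU : ∀ᶠ n : ℕ in atTop, ∀ q ∈ U, q.2 ≤ n :=
    (Filter.eventually_all_finset U).2 fun q _ =>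
      tendsto_natCast_atTop_atTop.eventually (eventually_ge_atTop q.2)
  filter_upwards [hev, hFU, htU] with n h1 h2 h3
  set d : ℝ≥0 := (n : ℝ≥0) / N n with hd
  have hnd : (N n : ℝ≥0) * d = n := by
    have hNp : (N n : ℝ≥0) ≠ 0 := by exact_mod_cast (hN2 n).ne'
    rw [hd]; field_simp
  have h4 := h1 (F n) (N n) fun q hq => ⟨h2 q hq, by rw [hnd]; exact h3 q hq⟩
  rw [hUk] at h4
  have h5 : ((F n ×ˢ Finset.range (N n)).filter fun a => Z.pos a.1 (a.2 * d) ω = y ∧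
      Z.pos a.1 ((a.2 + 1 : ℕ) * d) ω ≠ y ∧ Z.pos a.1 ((a.2 + 1 : ℕ) * d) ω = x).card ≤ r := by
    refine le_trans (card_le_ncard_of_window (d := d) hfin fun a ha => ?_) hr
    obtain ⟨-, g1, g2, g3⟩ := Finset.mem_filter.1 ha
    have hne : Z.pos a.1 (a.2 * d) ω ≠ x := by rw [g1]; exact hyx.ne
    obtain ⟨τ, e1, e2, -, z, hz⟩ := IsRegularPath.exists_hop_into hω (grid_le d a.2) hne g3
    exact ⟨τ, e1, e2, z, hz⟩
  change L ≤ Z.moveProd (edgeFactor y x θ) (F n) d (N n) ω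
  have h6 : Z.moveProd (edgeFactor y x θ) (F n) d (N n) ω =
      (1 + θ) ^ ((F n ×ˢ Finset.range (N n)).filter fun a => Z.pos a.1 (a.2 * d) ω = y ∧
        Z.pos a.1 ((a.2 + 1 : ℕ) * d) ω ≠ y).card *
      (1 / 2) ^ ((F n ×ˢ Finset.range (N n)).filter fun a => Z.pos a.1 (a.2 * d) ω = y ∧
      Z.pos a.1 ((a.2 + 1 : ℕ) * d) ω ≠ y ∧ Z.pos a.1 ((a.2 + 1 : ℕ) * d) ω = x).card := by
    rw [moveProd]
    simp only [edgeFactor]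
    rw [Finset.prod_mul_distrib, Finset.prod_ite, Finset.prod_ite]
    simp only [Finset.prod_const, one_pow, mul_one]
  rw [h6, hL]
  refine mul_le_mul (pow_le_pow_right₀ (by linarith) h4)
    (pow_le_pow_of_le_one (by norm_num) (by norm_num) h5) (by positivity) (by positivity)

/-- Almost surely, if finitely many hops from one vertex occur, then finitely many hops from every
vertex occur. -/
theorem ae_finite_hopsFrom_all [Countable V] [IsProbabilityMeasure μ] (Z : ARW K η₀ lam μ)
    (hK : ReversibleWalk G K nb wt γ) (hG : G.Connected) :
    ∀ᵐ ω ∂μ, ∀ x y, (Z.hopsFromAt x ω).Finite → (Z.hopsFromAt y ω).Finite := by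
  have h1 : ∀ᵐ ω ∂μ, ∀ y x, G.Adj y x → (Z.hopsToAt x ω).Finite → (Z.hopsFromAt y ω).Finite := by
    rw [ae_all_iff]; intro y
    rw [ae_all_iff]; intro x
    by_cases h : G.Adj y x
    · filter_upwards [Z.ae_finite_hopsFrom_neighbor hK h] with ω hω _ using hω
    · exact ae_of_all _ fun ω h' => absurd h' h
  filter_upwards [h1, Z.ae_regular hK.kernel_self] with ω h1 hω x y hx
  obtain ⟨p⟩ := hG.preconnected x y
  induction p with
  | nil => exact hx
  | cons hadj p ih => exact ih (h1 _ _ hadj.symm (IsRegularPath.finite_hopsTo hω hx))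

end ARW

/-! ### Nonfixation -/

lemma exp_le_one_sub {t : ℝ} (h1 : t ≤ 1 / 2) :
    Real.exp (-(t + 2 * t ^ 2)) ≤ 1 - t := by
  rw [Real.exp_neg]
  refine inv_le_of_inv_le₀ (by linarith) ?_
  have h2 := Real.add_one_le_exp (t + 2 * t ^ 2)
  refine le_trans ?_ h2
  rw [inv_le_iff_one_le_mul₀ (by linarith)]
  nlinarith [mul_nonneg (sq_nonneg t) (show 0 ≤ 1 - 2 * t by linarith)]

namespace ARW

variable {V : Type u} {K : V → V → ℝ} {η₀ : V → ℕ} {lam : ℝ≥0∞} {Ω : Type w}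
  {m : MeasurableSpace Ω} {μ : Measure Ω} {G : SimpleGraph V} {nb : V → Finset V} {wt : V → ℝ}
  {γ : ℝ}

open Classical in
/-- The Doob transform factors of the function `f`, with a penalty for moves from `x`. -/
noncomputable def doobFactor (x : V) (a : ℝ) (f : V → ℝ) (b c : V) : ℝ :=
  if b = c then 1 else (if b = x then 1 - a else 1) * (f c / f b)

lemma stepAverage_doobFactor_le (hK : ReversibleWalk G K nb wt γ) {x : V} {s : Finset V}
    {h : V → ℝ} (hh : IsTestFunction K nb x s h) {a : ℝ} (ha0 : 0 < a) (ha1 : a ≤ 1 / 2) (b : V) :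
    stepAverage K nb (doobFactor x a (fun y => 1 - a * h y) b) b ≤ 1 := by
  classical
  set f : V → ℝ := fun y => 1 - a * h y with hf
  have hfpos : 0 < f b := by
    have := hh.le_one b
    have := hh.nonneg b
    simp only [hf]; nlinarith
  have h1 : stepAverage K nb (doobFactor x a f b) b
      = (if b = x then 1 - a else 1) / f b * stepAverage K nb f b := by
    simp only [stepAverage, Finset.mul_sum]
    refine Finset.sum_congr rfl fun z hz => ?_
    have hbz : b ≠ z := ((hK.mem_nb b z).1 hz).ne
    rw [doobFactor, if_neg hbz]
    ring
  have h2 : stepAverage K nb f b = 1 - a * stepAverage K nb h b :=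
    ReversibleWalk.stepAverage_sub_mul h hK 1 a b
  rw [h1, div_mul_eq_mul_div, div_le_one hfpos, h2]
  split_ifs with hb
  · have h3 : 0 ≤ stepAverage K nb h b :=
      Finset.sum_nonneg fun z _ => mul_nonneg (hK.kernel_nonneg b z) (hh.nonneg z)
    have := hh.le_one b
    simp only [hf]
    nlinarith [mul_nonneg (mul_nonneg (show 0 ≤ 1 - a by linarith) ha0.le) h3]
  · have := hh.subharmonic b hb
    simp only [hf]
    nlinarith

open Classical in
lemma prod_doobFactor (x : V) (a : ℝ) (f : V → ℝ) (hf : ∀ y, f y ≠ 0) (X : ℕ → V) (n : ℕ) :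
    ∏ i ∈ Finset.range n, doobFactor x a f (X i) (X (i + 1)) =
      f (X n) / f (X 0) *
        ∏ i ∈ Finset.range n, (if X i = x ∧ X (i + 1) ≠ x then 1 - a else 1) := by
  induction n with
  | zero => simp [hf]
  | succ n ih =>
    have hstep : doobFactor x a f (X n) (X (n + 1)) =
        f (X (n + 1)) / f (X n) * (if X n = x ∧ X (n + 1) ≠ x then 1 - a else 1) := by
      unfold doobFactor
      by_cases h : X n = X (n + 1)
      · rw [if_pos h, ← h, div_self (hf _), if_neg (by tauto), mul_one]
      · rw [if_neg h, mul_comm]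
        congr 1
        by_cases hx : X n = x
        · rw [if_pos hx, if_pos ⟨hx, fun h' => h (hx.trans h'.symm)⟩]
        · rw [if_neg hx, if_neg fun h' => hx h'.1]
    rw [Finset.prod_range_succ, Finset.prod_range_succ, ih, hstep]
    have h1 := hf (X n)
    have h2 := hf (X 0)
    field_simp

/-- The particles that start in `s`. -/
def startingIn (η₀ : V → ℕ) (s : Finset V) : Finset (Particle η₀) :=
  s.sigma fun _ => Finset.univ

lemma prod_startingIn (s : Finset V) (f : V → ℝ) :
    ∏ p ∈ startingIn η₀ s, f p.1 = ∏ y ∈ s, f y ^ η₀ y := by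
  rw [startingIn, Finset.prod_sigma]
  refine Finset.prod_congr rfl fun y _ => ?_
  simp

/-- If the particles of `F` in `s` are at distinct vertices, then the product of `f` over the
particles is bounded below by the product over `s`. -/
lemma prod_le_prod_pos {ι : Type v} (F : Finset ι) (s : Finset V) (f : V → ℝ)
    (hf0 : ∀ y, 0 < f y) (hf1 : ∀ y, f y ≤ 1) (hfs : ∀ y, y ∉ s → f y = 1) (X : ι → V)
    (hX : ∀ p q, X p ∈ s → X p = X q → p = q) : ∏ y ∈ s, f y ≤ ∏ p ∈ F, f (X p) := by
  classical
  have h1 : ∏ p ∈ F, f (X p) = ∏ p ∈ F.filter fun p => X p ∈ s, f (X p) := by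
    refine (Finset.prod_subset (Finset.filter_subset _ _) fun p hp hp' => hfs _ fun h => ?_).symm
    exact hp' (Finset.mem_filter.2 ⟨hp, h⟩)
  have h2 : ∏ p ∈ F.filter fun p => X p ∈ s, f (X p)
      = ∏ y ∈ (F.filter fun p => X p ∈ s).image X, f y :=
    (Finset.prod_image fun p hp q _ hpq => hX p q (Finset.mem_filter.1 hp).2 hpq).symm
  rw [h1, h2]
  have hsub : (F.filter fun p => X p ∈ s).image X ⊆ s := by
    intro y hy
    obtain ⟨p, hp, rfl⟩ := Finset.mem_image.1 hy
    exact (Finset.mem_filter.1 hp).2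
  rw [← Finset.prod_sdiff hsub]
  exact mul_le_of_le_one_left (Finset.prod_nonneg fun y _ => (hf0 y).le)
    (Finset.prod_le_one (fun y _ => (hf0 y).le) fun y _ => hf1 y)

lemma exp_le_prod_div_prod {x : V} {s : Finset V} {h : V → ℝ} (hh : IsTestFunction K nb x s h)
    {a : ℝ} (ha0 : 0 < a) (ha1 : a ≤ 1 / 2) :
    Real.exp (a * ∑ y ∈ s, ((η₀ y : ℝ) - 1 - 2 * a) * h y) ≤
      (∏ y ∈ s, (1 - a * h y)) / ∏ y ∈ s, (1 - a * h y) ^ η₀ y := by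
  rw [Finset.mul_sum, Real.exp_sum, ← Finset.prod_div_distrib]
  refine Finset.prod_le_prod (fun y _ => (Real.exp_pos _).le) fun y _ => ?_
  have h0 := hh.nonneg y
  have h1 := hh.le_one y
  have hah : 0 ≤ a * h y := mul_nonneg ha0.le h0
  have hah' : a * h y ≤ 1 / 2 := by nlinarith
  have hpos : 0 < 1 - a * h y := by linarith
  rw [le_div_iff₀ (pow_pos hpos _)]
  calc Real.exp (a * (((η₀ y : ℝ) - 1 - 2 * a) * h y)) * (1 - a * h y) ^ η₀ y
      ≤ Real.exp (a * (((η₀ y : ℝ) - 1 - 2 * a) * h y)) * Real.exp (-(a * h y)) ^ η₀ y := by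
        refine mul_le_mul_of_nonneg_left (pow_le_pow_left₀ hpos.le ?_ _) (Real.exp_pos _).le
        have := Real.add_one_le_exp (-(a * h y))
        linarith
    _ = Real.exp (-(a * h y + 2 * (a * (a * h y)))) := by
        rw [← Real.exp_nat_mul, ← Real.exp_add]
        congr 1
        ring
    _ ≤ Real.exp (-(a * h y + 2 * (a * h y) ^ 2)) := by
        refine Real.exp_le_exp.2 ?_
        have : (a * h y) ^ 2 ≤ a * (a * h y) := by
          rw [sq]
          exact mul_le_mul_of_nonneg_right (by nlinarith) hah
        linarith
    _ ≤ 1 - a * h y := exp_le_one_sub hah'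

/-- If the initial occupation is supercritical when tested against suitable functions, then
almost surely it does not happen that finitely many hops from every vertex occur. -/
theorem ae_exists_infinite_hopsFrom [Countable V] [IsProbabilityMeasure μ] (Z : ARW K η₀ lam μ)
    (hK : ReversibleWalk G K nb wt γ) (x : V) {a : ℝ} (ha0 : 0 < a) (ha1 : a ≤ 1 / 2)
    (hη : ∀ C : ℝ, ∃ s h, IsTestFunction K nb x s h ∧
      C ≤ ∑ y ∈ s, ((η₀ y : ℝ) - 1 - 2 * a) * h y) :
    ∀ᵐ ω ∂μ, ∃ y, ¬ (Z.hopsFromAt y ω).Finite := by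
  classical
  suffices hr : ∀ r : ℕ, μ {ω | (∀ y, (Z.hopsFromAt y ω).Finite) ∧
      (Z.hopsFromAt x ω).ncard ≤ r} = 0 by
    have h' : ∀ᵐ ω ∂μ, ∀ r : ℕ, ¬ ((∀ y, (Z.hopsFromAt y ω).Finite) ∧
        (Z.hopsFromAt x ω).ncard ≤ r) := by
      rw [ae_all_iff]; intro r
      rw [ae_iff]
      simpa only [not_not] using hr r
    filter_upwards [h'] with ω hω
    by_contra! hfin
    exact hω _ ⟨hfin, le_rfl⟩
  intro r
  refine eq_zero_of_forall_mul_le (measure_ne_top μ _) fun C => ?_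
  have hpen : 0 < (1 - a) ^ r := pow_pos (by linarith) r
  obtain ⟨s, h, hh, hC⟩ := hη (C / (1 - a) ^ r / a)
  set L : ℝ := (1 - a) ^ r * Real.exp (a * ∑ y ∈ s, ((η₀ y : ℝ) - 1 - 2 * a) * h y) with hL
  refine ⟨L, ?_, ?_⟩
  · rw [div_le_iff₀ ha0] at hC
    rw [hL, ← div_le_iff₀' hpen]
    refine hC.trans ?_
    rw [mul_comm]
    exact (lt_add_one _).le.trans (Real.add_one_le_exp _)
  set f : V → ℝ := fun y => 1 - a * h y with hf
  have hf_half : ∀ y, 1 / 2 ≤ f y := fun y => by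
    have := hh.le_one y
    have := hh.nonneg y
    simp only [hf]; nlinarith
  have hf_pos : ∀ y, 0 < f y := fun y => by linarith [hf_half y]
  have hf_one : ∀ y, f y ≤ 1 := fun y => by
    have := hh.nonneg y
    simp only [hf]; nlinarith
  have hf_off : ∀ y, y ∉ s → f y = 1 := fun y hy => by simp [hf, hh.support y hy]
  have hgrid := fun n : ℕ => Z.exists_moveProd_le hK (doobFactor x a f) 2
    (fun b c => by
      have := (div_pos (hf_pos c) (hf_pos b)).le
      unfold doobFactor
      split_ifs
      · norm_num
      · exact mul_nonneg (by linarith) this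
      · linarith)
    (fun b => by unfold doobFactor; rw [if_pos rfl])
    (fun b c => by
      have h1 : f c / f b ≤ 2 := by
        rw [div_le_iff₀ (hf_pos b)]
        linarith [hf_one c, hf_half b]
      have h2 := (div_pos (hf_pos c) (hf_pos b)).le
      unfold doobFactor
      split_ifs
      · norm_num
      · nlinarith
      · linarith)
    (stepAverage_doobFactor_le hK hh ha0 ha1) (startingIn η₀ s) n L 0
  choose N _ hN2 hN3 using hgrid
  refine mul_measure_le_of_eventually (S := fun n => {ω | L ≤
    Z.moveProd (doobFactor x a f) (startingIn η₀ s) (n / N n) (N n) ω}) ?_ hN3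
  filter_upwards [Z.ae_regular hK.kernel_self] with ω hω
  rintro ⟨hfin, hr⟩
  obtain ⟨T, hT⟩ := IsRegularPath.exists_time_alone hω s fun y _ => hfin y
  filter_upwards [tendsto_natCast_atTop_atTop.eventually (eventually_ge_atTop T)] with n hn
  set d : ℝ≥0 := (n : ℝ≥0) / N n with hd
  have hnd : (N n : ℝ≥0) * d = n := by
    have hNp : (N n : ℝ≥0) ≠ 0 := by exact_mod_cast (hN2 n).ne'
    rw [hd]; field_simp
  change L ≤ Z.moveProd (doobFactor x a f) (startingIn η₀ s) d (N n) ω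
  have hprod : Z.moveProd (doobFactor x a f) (startingIn η₀ s) d (N n) ω =
      ((∏ p ∈ startingIn η₀ s, f (Z.pos p n ω)) / ∏ y ∈ s, f y ^ η₀ y) *
      (1 - a) ^ ((startingIn η₀ s ×ˢ Finset.range (N n)).filter fun b =>
        Z.pos b.1 (b.2 * d) ω = x ∧ Z.pos b.1 ((b.2 + 1 : ℕ) * d) ω ≠ x).card := by
    have h1 : ∀ p, ∏ i ∈ Finset.range (N n), doobFactor x a f (Z.pos p (i * d) ω)
        (Z.pos p ((i + 1 : ℕ) * d) ω) = f (Z.pos p n ω) / f p.1 *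
        ∏ i ∈ Finset.range (N n), (if Z.pos p (i * d) ω = x ∧
          Z.pos p ((i + 1 : ℕ) * d) ω ≠ x then 1 - a else 1) := by
      intro p
      have h2 := prod_doobFactor x a f (fun y => (hf_pos y).ne')
        (fun i => Z.pos p (i * d) ω) (N n)
      have h3 : Z.pos p ((0 : ℕ) * d) ω = p.1 := by
        rw [Nat.cast_zero, zero_mul]
        exact hω.init p
      simp only [hnd, h3] at h2
      exact h2
    rw [moveProd, Finset.prod_product]
    simp only [h1]
    rw [Finset.prod_mul_distrib, Finset.prod_div_distrib, prod_startingIn]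
    congr 1
    rw [← Finset.prod_product (f := fun b : Particle η₀ × ℕ => if Z.pos b.1 (b.2 * d) ω = x ∧
          Z.pos b.1 ((b.2 + 1 : ℕ) * d) ω ≠ x then 1 - a else 1), Finset.prod_ite]
    simp only [Finset.prod_const, one_pow, mul_one]
  have hcard : ((startingIn η₀ s ×ˢ Finset.range (N n)).filter fun b =>
      Z.pos b.1 (b.2 * d) ω = x ∧ Z.pos b.1 ((b.2 + 1 : ℕ) * d) ω ≠ x).card ≤ r := by
    refine le_trans (card_le_ncard_of_window (d := d) (hfin x) fun b hb => ?_) hr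
    obtain ⟨-, g1, g2⟩ := Finset.mem_filter.1 hb
    obtain ⟨τ, e1, e2, -, z, hz⟩ := IsRegularPath.exists_hop_out hω (grid_le d b.2) g1 g2
    exact ⟨τ, e1, e2, z, hz⟩
  have hden : 0 < ∏ y ∈ s, f y ^ η₀ y := Finset.prod_pos fun y _ => pow_pos (hf_pos y) _
  rw [hprod, hL, mul_comm]
  refine mul_le_mul ((exp_le_prod_div_prod hh ha0 ha1).trans ?_)
    (pow_le_pow_of_le_one (by linarith) (by linarith) hcard) hpen.le
    (div_nonneg (Finset.prod_nonneg fun p _ => (hf_pos _).le) hden.le)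
  exact div_le_div_of_nonneg_right (prod_le_prod_pos _ s f hf_pos hf_one hf_off _
    fun p q => hT n hn p q) hden.le

end ARW

/-- A criterion for nonfixation in terms of the initial occupation. -/
theorem nonfixatingAt_of_test {V : Type u} [Countable V] {K : V → V → ℝ} {η₀ : V → ℕ}
    {G : SimpleGraph V} {nb : V → Finset V} {wt : V → ℝ} {γ : ℝ}
    (hK : ReversibleWalk G K nb wt γ) (hG : G.Connected) (x : V) {a : ℝ} (ha0 : 0 < a)
    (ha1 : a ≤ 1 / 2)
    (hη : ∀ C : ℝ, ∃ s h, IsTestFunction K nb x s h ∧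
      C ≤ ∑ y ∈ s, ((η₀ y : ℝ) - 1 - 2 * a) * h y) :
    NonfixatingAt.{u, w} K η₀ x := by
  intro lam _ Ω _ μ hμ Z r
  filter_upwards [Z.ae_exists_infinite_hopsFrom hK x ha0 ha1 hη, Z.ae_finite_hopsFrom_all hK hG,
    Z.ae_regular hK.kernel_self] with ω h1 h2 hω
  obtain ⟨y, hy⟩ := h1
  have hinf : (Z.visitTimes x ω).Infinite := fun hfin =>
    hy (h2 x y (IsRegularPath.finite_hopsFrom hω hfin))
  rw [hinf.encard_eq]
  exact le_top

/-! ### Random initial occupations -/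

/-- Chebyshev's inequality for weighted sums of uncorrelated random variables. -/
lemma measureReal_sum_lt_le {V : Type u} {Ω : Type v} [MeasurableSpace Ω] (P : Measure Ω)
    [IsProbabilityMeasure P] (X : V → Ω → ℝ) {ε B : ℝ} (hε : 0 < ε)
    (hL2 : ∀ x, MemLp (X x) 2 P) (hmean : ∀ x, ∫ ω, X x ω ∂P = 1 + ε)
    (hvar : ∀ x, variance (X x) P ≤ B)
    (huncor : ∀ x y, x ≠ y → covariance (X x) (X y) P = 0)
    (s : Finset V) (h : V → ℝ) (h0 : ∀ y, 0 ≤ h y) (h1 : ∀ y, h y ≤ 1) {C : ℝ} (hC0 : 0 < C)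
    (hC : 4 * C ≤ ε * ∑ y ∈ s, h y) :
    P.real {ω | ∑ y ∈ s, (X y ω - 1 - ε / 2) * h y < C} ≤ 16 * B / (ε ^ 2 * ∑ y ∈ s, h y) := by
  classical
  set H := ∑ y ∈ s, h y with hH
  have hHpos : 0 < H := by
    by_contra! hle
    nlinarith
  have hmem : ∀ y ∈ s, MemLp (fun ω => X y ω * h y) 2 P := fun y _ => by
    simpa only [mul_comm] using (hL2 y).const_mul (h y)
  have hmemS : MemLp (fun ω => ∑ y ∈ s, X y ω * h y) 2 P := memLp_finsetSum _ hmem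
  have hexp : ∫ ω, ∑ y ∈ s, X y ω * h y ∂P = (1 + ε) * H := by
    rw [integral_finsetSum _ fun y hy => (hmem y hy).integrable (by norm_num), hH, Finset.mul_sum]
    exact Finset.sum_congr rfl fun y _ => by rw [integral_mul_const, hmean]
  have hvarS : variance (fun ω => ∑ y ∈ s, X y ω * h y) P ≤ B * H := by
    rw [variance_fun_sum' hmem, hH, Finset.mul_sum]
    refine Finset.sum_le_sum fun y hy => ?_
    rw [Finset.sum_eq_single_of_mem y hy fun z _ hzy => by
      rw [covariance_mul_const_left, covariance_mul_const_right, huncor y z hzy.symm]; ring]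
    rw [covariance_self (hmem y hy).aemeasurable, variance_mul_const]
    have hv := variance_nonneg (X y) P
    have hv' := hvar y
    have h2 : h y ^ 2 ≤ h y := by nlinarith [h0 y, h1 y]
    calc variance (X y) P * h y ^ 2 ≤ variance (X y) P * h y := mul_le_mul_of_nonneg_left h2 hv
      _ ≤ B * h y := mul_le_mul_of_nonneg_right hv' (h0 y)
  have hc : 0 < ε * H / 4 := by positivity
  have hcheb := meas_ge_le_variance_div_sq hmemS hc
  have hsub : {ω | ∑ y ∈ s, (X y ω - 1 - ε / 2) * h y < C} ⊆
      {ω | ε * H / 4 ≤ |∑ y ∈ s, X y ω * h y - ∫ ω, ∑ y ∈ s, X y ω * h y ∂P|} := by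
    intro ω hω
    have h2 : ∑ y ∈ s, (X y ω - 1 - ε / 2) * h y
        = ∑ y ∈ s, X y ω * h y - (1 + ε / 2) * H := by
      rw [hH, Finset.mul_sum, ← Finset.sum_sub_distrib]
      exact Finset.sum_congr rfl fun y _ => by ring
    simp only [Set.mem_ofPred_eq, h2] at hω
    simp only [Set.mem_ofPred_eq, hexp]
    rw [abs_sub_comm]
    refine le_trans ?_ (le_abs_self _)
    nlinarith
  calc P.real {ω | ∑ y ∈ s, (X y ω - 1 - ε / 2) * h y < C}
      ≤ variance (fun ω => ∑ y ∈ s, X y ω * h y) P / (ε * H / 4) ^ 2 := by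
        refine ENNReal.toReal_le_of_le_ofReal (div_nonneg (variance_nonneg _ _) (by positivity)) ?_
        exact (measure_mono hsub).trans hcheb
    _ ≤ B * H / (ε * H / 4) ^ 2 := div_le_div_of_nonneg_right hvarS (by positivity)
    _ = 16 * B / (ε ^ 2 * H) := by field_simp; ring

theorem ae_exists_testFunction {V : Type u} [Countable V] [Infinite V]
    {Ω : Type v} [MeasurableSpace Ω] (P : Measure Ω)
    [IsProbabilityMeasure P] (X : V → Ω → ℝ) {ε B : ℝ} (hε : 0 < ε)
    (hL2 : ∀ x, MemLp (X x) 2 P) (hmean : ∀ x, ∫ ω, X x ω ∂P = 1 + ε)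
    (hvar : ∀ x, variance (X x) P ≤ B)
    (huncor : ∀ x y, x ≠ y → covariance (X x) (X y) P = 0)
    {K : V → V → ℝ} {G : SimpleGraph V} {nb : V → Finset V} {wt : V → ℝ} {γ : ℝ}
    (hK : ReversibleWalk G K nb wt γ) (hG : G.Connected) :
    ∀ᵐ ω ∂P, ∀ x, ∀ C : ℝ, ∃ s h, IsTestFunction K nb x s h ∧
      C ≤ ∑ y ∈ s, (X y ω - 1 - ε / 2) * h y := by
  have hB : 0 ≤ B := by
    obtain ⟨x⟩ : Nonempty V := inferInstance
    exact (variance_nonneg _ _).trans (hvar x)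
  have hnat : ∀ᵐ ω ∂P, ∀ x, ∀ k : ℕ, ∃ s h, IsTestFunction K nb x s h ∧
      ((k : ℝ) + 1) ≤ ∑ y ∈ s, (X y ω - 1 - ε / 2) * h y := by
    rw [ae_all_iff]; intro x
    rw [ae_all_iff]; intro k
    rw [ae_iff]
    refine (measureReal_eq_zero_iff).1 (le_antisymm (le_of_forall_pos_le_add fun δ hδ => ?_)
      measureReal_nonneg)
    obtain ⟨s, h, hh, hM⟩ := hK.exists_testFunction hG x
      (4 * ((k : ℝ) + 1) / ε + (16 * B / ε ^ 2) / δ)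
    have hk : (0 : ℝ) < k + 1 := by positivity
    have hHpos : 0 < ∑ y ∈ s, h y := lt_of_lt_of_le (by positivity) hM
    have hC : 4 * ((k : ℝ) + 1) ≤ ε * ∑ y ∈ s, h y := by
      rw [← div_le_iff₀' hε]
      exact le_trans (le_add_of_nonneg_right (by positivity)) hM
    have h1 := measureReal_sum_lt_le P X hε hL2 hmean hvar huncor s h hh.nonneg hh.le_one hk hC
    rw [zero_add]
    refine le_trans (measureReal_mono fun ω hω => ?_) (h1.trans ?_)
    · by_contra hle
      exact hω ⟨s, h, hh, not_lt.1 hle⟩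
    · have h2 : 16 * B / ε ^ 2 / δ ≤ ∑ y ∈ s, h y :=
        le_trans (le_add_of_nonneg_left (by positivity)) hM
      rw [div_le_iff₀ hδ, div_le_iff₀ (by positivity)] at h2
      rw [div_le_iff₀ (by positivity)]
      linarith
  filter_upwards [hnat] with ω hω x C
  obtain ⟨k, hk⟩ := exists_nat_ge C
  obtain ⟨s, h, hh, hs⟩ := hω x k
  exact ⟨s, h, hh, by linarith⟩

theorem ae_nonfixating {V : Type u} [Countable V] [Infinite V]
    {Ω : Type v} [MeasurableSpace Ω] (P : Measure Ω) [IsProbabilityMeasure P]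
    (η₀ : V → Ω → ℕ) {ε B : ℝ} (hε : 0 < ε)
    (hL2 : ∀ x, MemLp (fun ω => (η₀ x ω : ℝ)) 2 P)
    (hmean : ∀ x, ∫ ω, (η₀ x ω : ℝ) ∂P = 1 + ε)
    (hvar : ∀ x, variance (fun ω => (η₀ x ω : ℝ)) P ≤ B)
    (huncor : ∀ x y, x ≠ y →
      covariance (fun ω => (η₀ x ω : ℝ)) (fun ω => (η₀ y ω : ℝ)) P = 0)
    {K : V → V → ℝ} {G : SimpleGraph V} {nb : V → Finset V} {wt : V → ℝ} {γ : ℝ}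
    (hK : ReversibleWalk G K nb wt γ) (hG : G.Connected) :
    ∀ᵐ ω ∂P, Nonfixating.{u, w} K (fun x => η₀ x ω) := by
  filter_upwards [ae_exists_testFunction P (fun x ω => (η₀ x ω : ℝ)) hε hL2 hmean hvar huncor
    hK hG] with ω hω x
  refine nonfixatingAt_of_test hK hG x (a := min (ε / 4) (1 / 2)) (by positivity)
    (min_le_right _ _) fun C => ?_
  obtain ⟨s, h, hh, hs⟩ := hω x C
  refine ⟨s, h, hh, hs.trans (Finset.sum_le_sum fun y _ => ?_)⟩
  refine mul_le_mul_of_nonneg_right ?_ (hh.nonneg y)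
  have := min_le_left (ε / 4) (1 / 2)
  linarith

theorem mainTheorem1 {V : Type u} [Countable V] [Infinite V]
    {Ω : Type v} [MeasurableSpace Ω] (P : Measure Ω) [IsProbabilityMeasure P]
    (η₀ : V → Ω → ℕ) (ε B : ℝ) (hε : 0 < ε)
    (hmeas : ∀ x, Measurable (η₀ x))
    (hL2 : ∀ x, MemLp (fun ω => (η₀ x ω : ℝ)) 2 P)
    (hmean : ∀ x, ∫ ω, (η₀ x ω : ℝ) ∂P = 1 + ε)
    (hvar : ∀ x, variance (fun ω => (η₀ x ω : ℝ)) P ≤ B)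
    (huncor : ∀ x y, x ≠ y →
      covariance (fun ω => (η₀ x ω : ℝ)) (fun ω => (η₀ y ω : ℝ)) P = 0) :
    (∀ (S : Network V) (γ : ℝ), S.graph.Connected → S.IsBounded γ →
      ∀ᵐ ω ∂P, Nonfixating.{u, w} S.kernel (fun x => η₀ x ω)) ∧
    (∀ (G : SimpleGraph V) (d : ℕ), G.Connected → (∀ x, (G.neighborSet x).encard ≤ d) →
      ∀ᵐ ω ∂P, Nonfixating.{u, w} (graphKernel G) (fun x => η₀ x ω)) := by
  have hnet : ∀ (S : Network V) (γ : ℝ), S.graph.Connected → S.IsBounded γ →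
      ∀ᵐ ω ∂P, Nonfixating.{u, w} S.kernel (fun x => η₀ x ω) := by
    intro S γ hS hb
    obtain ⟨nb, wt, γ', hK⟩ := hb.exists_reversibleWalk
    exact ae_nonfixating P η₀ hε hL2 hmean hvar huncor hK hS
  refine ⟨hnet, fun G d hG hd => ?_⟩
  have hfin : ∀ x, (G.neighborSet x).Finite := fun x =>
    Set.finite_of_encard_le_coe (hd x)
  have h := hnet (unitNetwork G) _ hG (unitNetwork_isBounded hG hfin hd)
  rwa [unitNetwork_kernel G hfin] at h
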